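/- **Setting.** Let $N$ be a random variable with values in $\{0,1,2,\dots\}\cup\{\infty\}$ and let $H(t)=\sum_{n<\infty}P(N=n)\,t^n$ for $t\in[0,1]$. Assume that $H(0)=0$ and that $H$ is strictly convex on $[0,1]$. Let $\mathbf T=\bigcup_{n\ge 0}\mathbb N^n$ be the tree with infinite branching, with $uj$ ($j\ge 1$) the daughters of $u$ and $|u|$ the generation of $u$, and let $(N_u)_{u\in\mathbf T}$ be independent copies of $N$. Consider the iterated recursive distributional equation (RDE) on $[0,1]$ $$X\overset{d}{=}1-\prod_{i=1}^{N_\emptyset}\Bigl(1-\prod_{j=1}^{N_i}X_{ij}\Bigr),\qquad (*)$$ where the $X_{ij}$ are independent copies of $X$, independent of $(N_\emptyset,N_1,N_2,\dots)$. A solution of $(*)$ is a probability law on $[0,1]$ with this property. A tree-indexed solution is a $[0,1]$-valued process $(X_u)_{u\in\mathbf T,\ |u|\text{ even}}$ such that all $X_u$ have the same law; for every $n$ the variables $(X_u)_{|u|=2n}$ are mutually independent, and the family is independent of $(N_v)_{|v|<2n}$; and almost surely $X_u=1-\prod_{i=1}^{N_u}(1-\prod_{j=1}^{N_{ui}}X_{uij})$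 for every $u$ of even generation. It is endogenous if each $X_u$ is almost surely equal to a $\sigma(N_v;v\in\mathbf T)$-measurable variable. **Theorem 6.2.** Let $f^{(2)}(t)=1-H(1-H(t))$ and let $(\mu^1_+,\mu^1_-)$ be a two-cycle: $\mu^1_\pm\in[0,1]$, $\mu^1_-=1-H(\mu^1_+)$ and $\mu^1_+=1-H(\mu^1_-)$. ($\mu^1_+=\mu^1_-$ is allowed.) 1. There are at most two solutions of $(*)$ with mean $\mu^1_+$: the law on $\{0,1\}$ with mass $\mu^1_+$ at $1$ (the discrete solution), and a (possibly equal) law $\varsigma$, both of which are solutions with mean $\mu^1_+$. 2. On a suitable probability space carrying $(N_u)$ there is a $\{0,1\}$-valued tree-indexed solution $S^+$ with mean $\mu^1_+$. 3. On every probability space carrying $(N_u)$ there is an endogenous tree-indexed solution $C^+$ with mean $\mu^1_+$. It is unique up to almost sure equality among the endogenous tree-indexed solutions with that mean, and each $C^+_u$ has law $\varsigma$. For every $\{0,1\}$-valued tree-indexed solution $S^+$ with mean $\mu^1_+$ on that space, $C^+_u=P(S^+_u=1\mid N_v,\,v\in\mathbf T)$ almost surely for every $u$; moreover $S^+$ and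 $C^+$ fail to be almost surely equal if and only if their laws at a vertex are distinct. 4. If $0<\mu^1_+<1$, then the discrete law and $\varsigma$ are distinct if and only if $H'(\mu^1_-)H'(\mu^1_+)>1$. This holds if and only if $\mu^1_+$ is an unstable fixed point of $f^{(2)}$, and if and only if $\mu^1_-$ is, where unstable means $|(f^{(2)})'|>1$ at that point. 5. In the degenerate case $\mu^1_+\in\{0,1\}$ the two laws coincide. -/

import Mathlib

open MeasureTheory ProbabilityTheory unitInterval

universe w

/-- The generating function `H(t) = E[t^N]` of a family size `N` in `{0, 1, 2, …, ∞}` with law `d`: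
`H(t) = ∑ₙ P(N = n) tⁿ`, the sum over finite `n` (defective if `P(N = ∞) > 0`). -/
noncomputable def pgf (d : Measure ℕ∞) (t : ℝ) : ℝ :=
  ∑' n : ℕ, d.real {(n : ℕ∞)} * t ^ n

/-- The iterated first moment map `f⁽²⁾(t) = 1 - H(1 - H(t))`. -/
noncomputable def iterMeanMap (d : Measure ℕ∞) (t : ℝ) : ℝ :=
  1 - pgf d (1 - pgf d t)

/-- A fixed point of a map of the line that is unstable in the sense of its multiplier. -/
def IsUnstableFixedPoint (g : ℝ → ℝ) (x : ℝ) : Prop :=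
  g x = x ∧ 1 < |deriv g x|

/-- The product of the first `n` terms of a sequence in `[0,1]`, where `n = ∞` is allowed
(an infinite product in `[0,1]` always converges, possibly to `0`). -/
noncomputable def liveProd (n : ℕ∞) (x : ℕ → I) : I :=
  ∏' i : ℕ, if (i : ℕ∞) < n then x i else 1

/-- The right-hand side `1 - ∏_{i ≤ n} (1 - ∏_{j ≤ kᵢ} x_{ij})` of the iterated equation
(daughters are labelled from `0`; `σ x = 1 - x`). -/
noncomputable def iterStep (n : ℕ∞) (k : ℕ → ℕ∞) (x : ℕ → ℕ → I) : I :=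
  σ (liveProd n fun i => σ (liveProd (k i) fun j => x i j))

/-- The law of `1 - ∏_{i ≤ N} (1 - ∏_{j ≤ Nᵢ} X_{ij})` where `N, N₀, N₁, …` have law `d`,
the `X_{ij}` have law `ν`, and all of these are independent. -/
noncomputable def iterLaw (d : Measure ℕ∞) (ν : Measure I) : Measure I :=
  (d.prod ((Measure.infinitePi fun _ : ℕ => d).prod
    (Measure.infinitePi fun _ : ℕ × ℕ => ν))).map
      fun p => iterStep p.1 p.2.1 fun i j => p.2.2 (i, j)

/-- `ν` is a solution of the iterated recursive distributional equation. -/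
def IsSolutionLaw (d : Measure ℕ∞) (ν : Measure I) : Prop :=
  IsProbabilityMeasure ν ∧ iterLaw d ν = ν

/-- The mean of a law on `[0,1]`. -/
noncomputable def mean (ν : Measure I) : ℝ := ∫ x, (x : ℝ) ∂ν

/-- The law on `{0,1}` with mass `p` at `1` and `1 - p` at `0`. -/
noncomputable def twoPointLaw (p : ℝ) : Measure I :=
  ENNReal.ofReal p • Measure.dirac 1 + ENNReal.ofReal (1 - p) • Measure.dirac 0

/-- Vertices of the tree with infinite branching, `⋃ₙ ℕⁿ`; the daughters of `u` are `u ++ [i]`. -/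
abbrev Node := List ℕ

/-- Vertices at even depth. -/
abbrev EvenNode := {u : Node // Even u.length}

/-- The vertex `uij`. -/
def EvenNode.grandchild (u : EvenNode) (i j : ℕ) : EvenNode :=
  ⟨u.1 ++ [i, j], by
    rw [List.length_append]
    exact u.2.add even_two⟩

section Tree

variable {Ω : Type*} [MeasurableSpace Ω]

/-- `(N u)` are independent random variables with common law `d`. -/
structure IsFamilySizes (P : Measure Ω) (d : Measure ℕ∞) (N : Node → Ω → ℕ∞) : Prop where
  measurable : ∀ u, Measurable (N u)
  law : ∀ u, P.map (N u) = d
  indep : iIndepFun N P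

/-- The σ-algebra `σ(N u; u ∈ T)` of the random tree. -/
abbrev treeSigma (N : Node → Ω → ℕ∞) : MeasurableSpace Ω :=
  ⨆ u, MeasurableSpace.comap (N u) inferInstance

/-- Tree-indexed solutions of the iterated equation: the process lives on the even generations. -/
structure IsTreeSolution (P : Measure Ω) (N : Node → Ω → ℕ∞) (X : EvenNode → Ω → I) : Prop where
  measurable : ∀ u, Measurable (X u)
  /-- for every `n`, the variables in generation `2n` are mutually independent … -/
  indep : ∀ n : ℕ, iIndepFun (fun u : {u : EvenNode // u.1.length = 2 * n} => X u.1) P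
  /-- … and, jointly, independent of the family sizes in the generations before -/
  indep_tree : ∀ n : ℕ,
    IndepFun (fun ω (u : {u : EvenNode // u.1.length = 2 * n}) => X u.1 ω)
      (fun ω (v : {v : Node // v.length < 2 * n}) => N v.1 ω) P
  equation : ∀ u : EvenNode, ∀ᵐ ω ∂P,
    X u ω = iterStep (N u.1 ω) (fun i => N (u.1 ++ [i]) ω) (fun i j => X (u.grandchild i j) ω)
  stationary : ∀ u v : EvenNode, P.map (X u) = P.map (X v)

/-- A process is endogenous if it is a function of the random tree (up to null sets). -/
def IsEndogenous (P : Measure Ω) (N : Node → Ω → ℕ∞) (X : EvenNode → Ω → I) : Prop :=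
  ∀ u, ∃ Y : Ω → I, Measurable[treeSigma N] Y ∧ X u =ᵐ[P] Y

/-- A tree-indexed solution with values in `{0,1}` and mean `p`. -/
structure IsDiscreteTreeSolution (P : Measure Ω) (N : Node → Ω → ℕ∞) (p : ℝ)
    (S : EvenNode → Ω → I) : Prop where
  solution : IsTreeSolution P N S
  discrete : ∀ u, ∀ᵐ ω ∂P, S u ω = 0 ∨ S u ω = 1
  mean_eq : ∀ u, mean (P.map (S u)) = p

/-- The conditional probability `P(A | T)` given the random tree. -/
noncomputable def treeCondProb (P : Measure Ω) (N : Node → Ω → ℕ∞) (A : Set Ω) : Ω → ℝ :=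
  P[A.indicator (fun _ => (1 : ℝ)) | treeSigma N]

end Tree

/-! ### Finite and infinite products in the unit interval. -/

open Filter Topology

/-! The iterated equation is the one-step map `stepLaw`, the law of `1 - ∏ Xᵢ`, applied twice
(`iterLaw_eq`). Expectation commutes with products of independent variables, so one step sends the
first two moments (a, s) to (1 - H(a), 1 - 2H(a) + H(s)). For a solution with mean p in a two-cycle
(p, m), the second moment is therefore a fixed point in [p², p] of Φ(x) = 2p - 1 + H(2m - 1 + H(x)),
which is `momentMap`. Where its inner argument is nonnegative, Φ is strictly convex on the part
below p; it fixes p, so it has at most one fixed point smaller than p (`eq_of_momentMap_eq`). Second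
moment p forces the two-point law, because x² ≤ x on [0,1].

The endogenous solution comes from a martingale. Given the family sizes before generation 2n, the
conditional expectation of a tree-indexed solution is what the recursion makes of constant labels p
in generation 2n (`cutoff`): the recursion is affine in each label and the labels are independent.
Lévy's upward theorem gives convergence to the conditional expectation given the whole tree
(`IsTreeSolution.tendsto_cutoff`). The limit C depends on the tree alone, so it is the same for all
solutions with mean p; the two-point law supplies one such solution, realised by an inverse limit
(`exists_labelled_tree`). C solves the recursion itself (`IsFamilySizes.cutoffLimit_equation`). An
endogenous solution is its own conditional expectation, hence equals C.

The second moments of the cut-off recursion are iterates of the monotone map Φ started at p². They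
stay below every x in [p², p] with Φ(x) ≤ x, so C has the least second moment of all solutions
(`secondMoment_endogenousLaw_le`). Any solution X thus has second moment p or that of C; in the
latter case X and E[X | T] = C have equal second moments and coincide. By convexity, Φ has a
relevant fixed point below p exactly when Φ'(p) = H'(m)H'(p) > 1, and Φ'(p) is also the derivative
of f⁽²⁾ at p. -/

theorem tendsto_liveProd (n : ℕ∞) (x : ℕ → I) :
    Tendsto (fun m => ∏ i ∈ Finset.range m, if (i : ℕ∞) < n then x i else 1) atTop
      (𝓝 (liveProd n x)) := by
  -- With factors at most 1, finite products decrease as the index set grows, so they converge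
  -- unconditionally to their infimum.
  have h := hasProd_of_isGLB_of_le_one (f := fun i : ℕ => if (i : ℕ∞) < n then x i else 1)
    (sInf (Set.range fun s : Finset ℕ => ∏ i ∈ s, if (i : ℕ∞) < n then x i else 1))
    (fun i => le_one') (isGLB_sInf _)
  rw [liveProd, h.tprod_eq]
  exact h.tendsto_prod_nat

theorem liveProd_coe (n : ℕ) (x : ℕ → I) : liveProd n x = ∏ i ∈ Finset.range n, x i := by
  refine tendsto_nhds_unique (tendsto_liveProd n x) ?_
  refine tendsto_const_nhds.congr' ?_
  filter_upwards [eventually_ge_atTop n] with m hm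
  rw [← Finset.prod_subset (Finset.range_mono hm)]
  · exact Finset.prod_congr rfl fun i hi => by simp [Finset.mem_range.1 hi]
  · intro i _ hi
    simp only [Finset.mem_range] at hi
    simp [hi]

theorem tendsto_liveProd_top (x : ℕ → I) :
    Tendsto (fun m => ∏ i ∈ Finset.range m, x i) atTop (𝓝 (liveProd ⊤ x)) := by
  simpa using tendsto_liveProd ⊤ x

theorem liveProd_mul (n : ℕ∞) (x y : ℕ → I) :
    liveProd n (fun i => x i * y i) = liveProd n x * liveProd n y := by
  refine tendsto_nhds_unique (tendsto_liveProd n _) ?_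
  refine ((tendsto_liveProd n x).mul (tendsto_liveProd n y)).congr fun m => ?_
  rw [← Finset.prod_mul_distrib]
  refine Finset.prod_congr rfl fun i _ => ?_
  split_ifs <;> simp

theorem liveProd_top_const {c : I} (hc : c ≠ 1) : liveProd ⊤ (fun _ => c) = 0 := by
  refine tendsto_nhds_unique (tendsto_liveProd_top _) ?_
  rw [tendsto_subtype_rng]
  simpa using tendsto_pow_atTop_nhds_zero_of_lt_one c.2.1
    (lt_of_le_of_ne c.2.2 fun h => hc (Subtype.ext h))

/-- Finiteness is essential: an infinite product is not continuous in its factors, as tails of zeros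
that recede to infinity show. -/
theorem tendsto_liveProd_of_ne_top {n : ℕ∞} (hn : n ≠ ⊤) {α : Type*} {l : Filter α}
    {x : α → ℕ → I} {y : ℕ → I} (h : ∀ i, Tendsto (fun a => x a i) l (𝓝 (y i))) :
    Tendsto (fun a => liveProd n (x a)) l (𝓝 (liveProd n y)) := by
  lift n to ℕ using hn
  simp only [liveProd_coe]
  exact tendsto_finsetProd _ fun i _ => h i

theorem Measurable.liveProd {Ω : Type*} {_ : MeasurableSpace Ω} {n : Ω → ℕ∞} {x : ℕ → Ω → I}
    (hn : Measurable n) (hx : ∀ i, Measurable (x i)) :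
    Measurable fun ω => liveProd (n ω) (fun i => x i ω) := by
  refine measurable_of_tendsto_metrizable (f := fun m ω =>
    ∏ i ∈ Finset.range m, if (i : ℕ∞) < n ω then x i ω else 1) (fun m => ?_) ?_
  · refine Finset.measurable_prod _ fun i _ => ?_
    exact Measurable.ite (hn (MeasurableSet.of_discrete (s := {k : ℕ∞ | (i : ℕ∞) < k}))) (hx i)
      measurable_const
  · rw [tendsto_pi_nhds]
    exact fun ω => tendsto_liveProd _ _

/-- The right-hand side `1 - ∏_{i ≤ n} xᵢ` of the (single-step) recursive equation. -/
noncomputable def vetoStep (n : ℕ∞) (x : ℕ → I) : I := σ (liveProd n x)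

theorem iterStep_eq (n : ℕ∞) (k : ℕ → ℕ∞) (x : ℕ → ℕ → I) :
    iterStep n k x = vetoStep n fun i => vetoStep (k i) (x i) := rfl

theorem Measurable.vetoStep {Ω : Type*} {_ : MeasurableSpace Ω} {n : Ω → ℕ∞} {x : ℕ → Ω → I}
    (hn : Measurable n) (hx : ∀ i, Measurable (x i)) :
    Measurable fun ω => vetoStep (n ω) (fun i => x i ω) :=
  unitInterval.continuous_symm.measurable.comp (hn.liveProd hx)

/-! ### Expectations of products of independent variables. -/

section Expectation

variable {Ω : Type*} [MeasurableSpace Ω] {P : Measure Ω}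

theorem integrable_unitInterval [IsFiniteMeasure P] {X : Ω → I} (hX : Measurable X) :
    Integrable (fun ω => (X ω : ℝ)) P :=
  Integrable.of_bound (by fun_prop) 1 (ae_of_all _ fun ω => by
    rw [Real.norm_of_nonneg (X ω).2.1]; exact (X ω).2.2)

theorem integral_unitInterval_mem [IsProbabilityMeasure P] {X : Ω → I} (hX : Measurable X) :
    ∫ ω, (X ω : ℝ) ∂P ∈ Set.Icc (0 : ℝ) 1 := by
  refine ⟨integral_nonneg fun ω => (X ω).2.1, ?_⟩
  calc ∫ ω, (X ω : ℝ) ∂P ≤ ∫ _, (1 : ℝ) ∂P :=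
        integral_mono (integrable_unitInterval hX) (integrable_const _) fun ω => (X ω).2.2
    _ = 1 := by simp

theorem tendsto_integral_unitInterval [IsFiniteMeasure P] {X : ℕ → Ω → I} {Y : Ω → I}
    (hX : ∀ n, Measurable (X n)) (h : ∀ᵐ ω ∂P, Tendsto (fun n => X n ω) atTop (𝓝 (Y ω))) :
    Tendsto (fun n => ∫ ω, (X n ω : ℝ) ∂P) atTop (𝓝 (∫ ω, (Y ω : ℝ) ∂P)) := by
  refine tendsto_integral_of_dominated_convergence (fun _ => (1 : ℝ)) (fun n => ?_)
    (integrable_const _) (fun n => ae_of_all _ fun ω => ?_) ?_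
  · exact (integrable_unitInterval (hX n)).1
  · rw [Real.norm_of_nonneg (X n ω).2.1]; exact (X n ω).2.2
  · filter_upwards [h] with ω hω
    exact (continuous_subtype_val.tendsto _).comp hω

/-- Expectation and product commute for independent variables in `[0,1]`. -/
theorem integral_liveProd [IsProbabilityMeasure P] {X : ℕ → Ω → I} (hX : ∀ i, Measurable (X i))
    (hind : iIndepFun X P) (n : ℕ∞) (m : ℕ → I) (hm : ∀ i, ∫ ω, (X i ω : ℝ) ∂P = m i) :
    ∫ ω, (liveProd n (fun i => X i ω) : ℝ) ∂P = liveProd n m := by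
  have key : ∀ k : ℕ, ∫ ω, ((∏ i ∈ Finset.range k, X i ω : I) : ℝ) ∂P
      = ((∏ i ∈ Finset.range k, m i : I) : ℝ) := by
    intro k
    have h2 : iIndepFun (fun (i : Fin k) ω => (X i ω : ℝ)) P :=
      (hind.precomp Fin.val_injective).comp (fun _ => Subtype.val) fun _ => measurable_subtype_coe
    have := h2.integral_fun_prod_eq_prod_integral (fun i => (integrable_unitInterval (hX i)).1)
    simp only [hm] at this
    have e : ∀ z : ℕ → I, ((∏ i ∈ Finset.range k, z i : I) : ℝ) = ∏ i : Fin k, (z i : ℝ) := by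
      intro z
      rw [Finset.prod_range]
      exact map_prod (Submonoid.subtype (unitInterval.submonoid)) _ _
    simp only [e]
    exact this
  rcases eq_or_ne n ⊤ with rfl | hn
  · refine tendsto_nhds_unique ?_
      ((continuous_subtype_val.tendsto _).comp (tendsto_liveProd_top m))
    refine (tendsto_integral_unitInterval (P := P) (fun k => ?_)
      (ae_of_all _ fun ω => tendsto_liveProd_top _)).congr key
    exact Finset.measurable_prod _ fun i _ => hX i
  · lift n to ℕ using hn
    simp only [liveProd_coe]
    exact key n

theorem integral_symm [IsProbabilityMeasure P] {X : Ω → I} (hX : Measurable X) :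
    ∫ ω, (σ (X ω) : ℝ) ∂P = 1 - ∫ ω, (X ω : ℝ) ∂P := by
  simp only [unitInterval.coe_symm_eq]
  rw [integral_sub (integrable_const _) (integrable_unitInterval hX)]
  simp

theorem integral_vetoStep [IsProbabilityMeasure P] {X : ℕ → Ω → I} (hX : ∀ i, Measurable (X i))
    (hind : iIndepFun X P) (n : ℕ∞) (m : ℕ → I) (hm : ∀ i, ∫ ω, (X i ω : ℝ) ∂P = m i) :
    ∫ ω, (vetoStep n (fun i => X i ω) : ℝ) ∂P = vetoStep n m := by
  unfold vetoStep
  rw [integral_symm (measurable_const.liveProd hX), integral_liveProd hX hind n m hm,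
    unitInterval.coe_symm_eq]

/-- The product is nonnegative with expectation `∏ c = 0`. This replaces the missing continuity of
infinite products at vertices with infinitely many daughters. -/
theorem liveProd_top_eq_zero_ae [IsProbabilityMeasure P] {X : ℕ → Ω → I}
    (hX : ∀ i, Measurable (X i)) (hind : iIndepFun X P) {c : ℝ} (hc : c < 1)
    (hm : ∀ i, ∫ ω, (X i ω : ℝ) ∂P = c) :
    ∀ᵐ ω ∂P, liveProd ⊤ (fun i => X i ω) = 0 := by
  have hc' : c ∈ Set.Icc (0 : ℝ) 1 := hm 0 ▸ integral_unitInterval_mem (hX 0)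
  have h := integral_liveProd hX hind ⊤ (fun _ => ⟨c, hc'⟩) hm
  rw [liveProd_top_const fun h => hc.ne (congrArg Subtype.val h), Set.Icc.coe_zero,
    integral_eq_zero_iff_of_nonneg (fun ω => (liveProd _ _).2.1)
      (integrable_unitInterval (measurable_const.liveProd hX))] at h
  filter_upwards [h] with ω hω
  exact Subtype.ext hω

end Expectation

/-! ### Grouping independent σ-algebras. -/

section Independence

variable {Ω : Type*} {mΩ : MeasurableSpace Ω} {P : Measure Ω}

/-- Induction on the number of groups: a new group is disjoint from the union of the earlier ones,
hence independent of everything they generate. -/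
theorem iIndep_biSup {ι κ : Type*} {m : ι → MeasurableSpace Ω} (hle : ∀ i, m i ≤ mΩ)
    (h : iIndep m P) {S : κ → Set ι} (hS : Pairwise fun k l => Disjoint (S k) (S l)) :
    iIndep (fun k => ⨆ i ∈ S k, m i) P := by
  classical
  have := h.isProbabilityMeasure
  rw [iIndep_iff]
  intro s
  induction s using Finset.induction_on with
  | empty => simp
  | insert a s ha ih =>
    intro f hf
    rw [Finset.set_biInter_insert, Finset.prod_insert ha,
      ← ih fun i hi => hf i (Finset.mem_insert_of_mem hi)]
    have hd : Disjoint (S a) (⋃ k ∈ s, S k) := by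
      simp only [Set.disjoint_iUnion_right]
      exact fun k hk => hS fun e => ha (e ▸ hk)
    refine (Indep_iff _ _ _).1 (indep_iSup_of_disjoint hle h hd) _ _
      (hf a (Finset.mem_insert_self a s)) ?_
    refine Finset.measurableSet_biInter s fun k hk => ?_
    refine (iSup₂_le fun i hi => ?_ : (⨆ i ∈ S k, m i) ≤ _) _ (hf k (Finset.mem_insert_of_mem hk))
    exact le_iSup₂_of_le i (Set.mem_biUnion hk hi) le_rfl

theorem iIndep_sumElim {ι κ : Type*} {m : ι → MeasurableSpace Ω} {m' : κ → MeasurableSpace Ω}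
    (h : iIndep m P) (h' : iIndep m' P) (hi : Indep (⨆ i, m i) (⨆ k, m' k) P) :
    iIndep (Sum.elim m m') P := by
  classical
  rw [iIndep_iff]
  intro s f hf
  have e : ⋂ i ∈ s, f i = (⋂ i ∈ s.toLeft, f (Sum.inl i)) ∩ ⋂ k ∈ s.toRight, f (Sum.inr k) := by
    ext ω
    simp
  rw [e, (Indep_iff _ _ _).1 hi, h.meas_biInter, h'.meas_biInter]
  · conv_rhs => rw [← Finset.toLeft_disjSum_toRight (u := s), Finset.prod_disjSum]
  · exact fun k hk => hf (Sum.inr k) (Finset.mem_toRight.1 hk)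
  · exact fun k hk => hf (Sum.inl k) (Finset.mem_toLeft.1 hk)
  · exact Finset.measurableSet_biInter _ fun i hi =>
      le_iSup m i _ (hf (Sum.inl i) (Finset.mem_toLeft.1 hi))
  · exact Finset.measurableSet_biInter _ fun i hi =>
      le_iSup m' i _ (hf (Sum.inr i) (Finset.mem_toRight.1 hi))

theorem iIndepFun_of_biSup {ι κ : Type*} {β : κ → Type*} [∀ k, MeasurableSpace (β k)]
    {m : ι → MeasurableSpace Ω} (hle : ∀ i, m i ≤ mΩ)
    (h : iIndep m P) {S : κ → Set ι} (hS : Pairwise fun k l => Disjoint (S k) (S l))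
    {X : ∀ k, Ω → β k} (hX : ∀ k, Measurable[⨆ i ∈ S k, m i] (X k)) : iIndepFun X P := by
  rw [iIndepFun_iff]
  intro s f hf
  exact (iIndep_iff _ _).1 (iIndep_biSup hle h hS) s fun i hi => (hX i).comap_le _ (hf i hi)

theorem indepFun_of_biSup {ι β γ : Type*} [MeasurableSpace β] [MeasurableSpace γ]
    {m : ι → MeasurableSpace Ω} (hle : ∀ i, m i ≤ mΩ)
    (h : iIndep m P) {S T : Set ι} (hST : Disjoint S T)
    {X : Ω → β} {Y : Ω → γ} (hX : Measurable[⨆ i ∈ S, m i] X) (hY : Measurable[⨆ i ∈ T, m i] Y) :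
    IndepFun X Y P :=
  indep_of_indep_of_le (indep_iSup_of_disjoint hle h hST) hX.comap_le hY.comap_le

theorem measurable_biSup_comap {ι β : Type*} [MeasurableSpace β] {S : Set ι} {X : ι → Ω → β}
    {i : ι} (hi : i ∈ S) : Measurable[⨆ i ∈ S, MeasurableSpace.comap (X i) inferInstance] (X i) :=
  (comap_measurable (X i)).mono (le_iSup₂_of_le i hi le_rfl) le_rfl

end Independence

/-! ### The one-step map on laws and its first two moments. -/

/-- The law of `1 - ∏_{i ≤ N} Xᵢ` where `N` has law `d`, the `Xᵢ` have law `ν`, and all of these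
are independent. -/
noncomputable def stepLaw (d : Measure ℕ∞) (ν : Measure I) : Measure I :=
  (d.prod (Measure.infinitePi fun _ : ℕ => ν)).map fun p => vetoStep p.1 p.2

theorem measurable_vetoStep_prod : Measurable fun p : ℕ∞ × (ℕ → I) => vetoStep p.1 p.2 :=
  measurable_fst.vetoStep fun i => (measurable_pi_apply i).comp measurable_snd

theorem map_vetoStep {d : Measure ℕ∞} {ν : Measure I} {Ω : Type*} [MeasurableSpace Ω] {P : Measure Ω} [IsProbabilityMeasure P]
    {N : Ω → ℕ∞} {X : ℕ → Ω → I} (hN : Measurable N) (hNd : P.map N = d)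
    (hX : ∀ i, Measurable (X i)) (hXν : ∀ i, P.map (X i) = ν) (hind : iIndepFun X P)
    (hNX : IndepFun N (fun ω i => X i ω) P) :
    P.map (fun ω => vetoStep (N ω) fun i => X i ω) = stepLaw d ν := by
  have hX' : Measurable fun ω i => X i ω := measurable_pi_lambda _ hX
  have h1 : P.map (fun ω => (N ω, fun i => X i ω)) =
      d.prod (Measure.infinitePi fun _ : ℕ => ν) := by
    rw [(indepFun_iff_map_prod_eq_prod_map_map hN.aemeasurable hX'.aemeasurable).1 hNX, hNd,
      (iIndepFun_iff_map_fun_eq_infinitePi_map hX).1 hind]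
    simp only [hXν]
  rw [stepLaw, ← h1, Measure.map_map measurable_vetoStep_prod (hN.prodMk hX')]
  rfl

section StepLaw

variable {d : Measure ℕ∞} [IsProbabilityMeasure d] {ν : Measure I} [IsProbabilityMeasure ν]

instance : IsProbabilityMeasure (stepLaw d ν) :=
  Measure.isProbabilityMeasure_map measurable_vetoStep_prod.aemeasurable

/-- The inner variables `Y i` use disjoint blocks of the independent data, so they are independent
with law `stepLaw d ν`, and independent of the root's family size. -/
theorem iterLaw_eq : iterLaw d ν = stepLaw d (stepLaw d ν) := by
  set P := d.prod ((Measure.infinitePi fun _ : ℕ => d).prod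
    (Measure.infinitePi fun _ : ℕ × ℕ => ν)) with hP
  let K : ℕ → ℕ∞ × (ℕ → ℕ∞) × (ℕ × ℕ → I) → ℕ∞ := fun i p => p.2.1 i
  let X : ℕ × ℕ → ℕ∞ × (ℕ → ℕ∞) × (ℕ × ℕ → I) → I := fun a p => p.2.2 a
  have hK : ∀ i, Measurable (K i) := fun i => by fun_prop
  have hX : ∀ a, Measurable (X a) := fun a => by fun_prop
  have hmap2 : P.map Prod.snd = (Measure.infinitePi fun _ : ℕ => d).prod
      (Measure.infinitePi fun _ : ℕ × ℕ => ν) := by simp [hP]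
  have hmapK : P.map (fun p => p.2.1) = Measure.infinitePi fun _ : ℕ => d := by
    rw [show (fun p : ℕ∞ × (ℕ → ℕ∞) × (ℕ × ℕ → I) => p.2.1) = Prod.fst ∘ Prod.snd from rfl,
      ← Measure.map_map measurable_fst measurable_snd, hmap2]
    simp
  have hmapX : P.map (fun p => p.2.2) = Measure.infinitePi fun _ : ℕ × ℕ => ν := by
    rw [show (fun p : ℕ∞ × (ℕ → ℕ∞) × (ℕ × ℕ → I) => p.2.2) = Prod.snd ∘ Prod.snd from rfl,
      ← Measure.map_map measurable_snd measurable_snd, hmap2]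
    simp
  have hKd : ∀ i, P.map (K i) = d := fun i => by
    rw [show K i = (fun k : ℕ → ℕ∞ => k i) ∘ (fun p => p.2.1) from rfl,
      ← Measure.map_map (by fun_prop) (by fun_prop), hmapK, Measure.infinitePi_map_eval]
  have hXν : ∀ a, P.map (X a) = ν := fun a => by
    rw [show X a = (fun k : ℕ × ℕ → I => k a) ∘ (fun p => p.2.2) from rfl,
      ← Measure.map_map (by fun_prop) (by fun_prop), hmapX, Measure.infinitePi_map_eval]
  have hKi : iIndepFun K P := by
    rw [iIndepFun_iff_map_fun_eq_infinitePi_map hK]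
    simp only [hKd]
    exact hmapK
  have hXi : iIndepFun X P := by
    rw [iIndepFun_iff_map_fun_eq_infinitePi_map hX]
    simp only [hXν]
    exact hmapX
  have hKX : IndepFun (fun p : ℕ∞ × (ℕ → ℕ∞) × (ℕ × ℕ → I) => p.2.1) (fun p => p.2.2) P := by
    rw [indepFun_iff_map_prod_eq_prod_map_map (by fun_prop) (by fun_prop), hmapK, hmapX]
    exact hmap2
  have hpair : Indep (⨆ i, MeasurableSpace.comap (K i) inferInstance)
      (⨆ a, MeasurableSpace.comap (X a) inferInstance) P := by
    refine indep_of_indep_of_le hKX (iSup_le fun i => ?_) (iSup_le fun a => ?_)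
    · exact ((measurable_pi_apply i).comp (comap_measurable
        (fun p : ℕ∞ × (ℕ → ℕ∞) × (ℕ × ℕ → I) => p.2.1))).comap_le
    · exact ((measurable_pi_apply a).comp (comap_measurable
        (fun p : ℕ∞ × (ℕ → ℕ∞) × (ℕ × ℕ → I) => p.2.2))).comap_le
  have hall := iIndep_sumElim hKi.iIndep hXi.iIndep hpair
  let Y : ℕ → ℕ∞ × (ℕ → ℕ∞) × (ℕ × ℕ → I) → I := fun i p => vetoStep (K i p) fun j => X (i, j) p
  have hYm : ∀ i, Measurable (Y i) := fun i => (hK i).vetoStep fun j => hX _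
  have hYν : ∀ i, P.map (Y i) = stepLaw d ν := fun i =>
    map_vetoStep (hK i) (hKd i) (fun j => hX _) (fun j => hXν _)
      (hXi.precomp (g := fun j => (i, j)) fun a b h => (Prod.ext_iff.1 h).2)
      (hKX.comp (φ := fun k : ℕ → ℕ∞ => k i) (ψ := fun x : ℕ × ℕ → I => fun j => x (i, j))
        (by fun_prop) (by fun_prop))
  have hYi : iIndepFun Y P := by
    refine iIndepFun_of_biSup (S := fun i => {a | a = Sum.inl i ∨ ∃ j, a = Sum.inr (i, j)})
      (fun a => ?_) hall (fun i j hij => ?_) fun i => ?_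
    · rcases a with a | a
      · exact (hK a).comap_le
      · exact (hX a).comap_le
    · refine Set.disjoint_left.2 ?_
      rintro a (rfl | ⟨k, rfl⟩) (h | ⟨l, h⟩) <;> simp_all
    · refine Measurable.vetoStep ?_ fun j => ?_
      · exact (comap_measurable (K i)).mono
          (le_iSup₂_of_le (f := fun a (_ : a ∈ _) => Sum.elim _ _ a) (Sum.inl i) (Or.inl rfl) le_rfl) le_rfl
      · exact (comap_measurable (X (i, j))).mono
          (le_iSup₂_of_le (f := fun a (_ : a ∈ _) => Sum.elim _ _ a) (Sum.inr (i, j)) (Or.inr ⟨j, rfl⟩) le_rfl) le_rfl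
  have hNY : IndepFun (fun p : ℕ∞ × (ℕ → ℕ∞) × (ℕ × ℕ → I) => p.1) (fun p i => Y i p) P := by
    have hY' : Measurable fun (q : (ℕ → ℕ∞) × (ℕ × ℕ → I)) (i : ℕ) =>
        vetoStep (q.1 i) fun j => q.2 (i, j) :=
      measurable_pi_lambda _ fun i => Measurable.vetoStep (by fun_prop) fun j => by fun_prop
    exact indepFun_prod measurable_id hY'
  exact map_vetoStep measurable_fst (by simp) hYm hYν hYi hNY

/-- The second moment of a law on `[0,1]`. -/
noncomputable def secondMoment (ν : Measure I) : ℝ := ∫ x, (x : ℝ) ^ 2 ∂ν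

theorem mean_map {Ω : Type*} [MeasurableSpace Ω] {P : Measure Ω} {X : Ω → I} (hX : Measurable X) :
    mean (P.map X) = ∫ ω, (X ω : ℝ) ∂P :=
  integral_map hX.aemeasurable (by fun_prop)

theorem secondMoment_map {Ω : Type*} [MeasurableSpace Ω] {P : Measure Ω} {X : Ω → I}
    (hX : Measurable X) : secondMoment (P.map X) = ∫ ω, (X ω : ℝ) ^ 2 ∂P :=
  integral_map hX.aemeasurable (by fun_prop)

theorem mean_mem (ν : Measure I) [IsProbabilityMeasure ν] : mean ν ∈ Set.Icc (0 : ℝ) 1 :=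
  integral_unitInterval_mem measurable_id

theorem secondMoment_eq (ν : Measure I) : secondMoment ν = ∫ x, ((x * x : I) : ℝ) ∂ν := by
  simp [secondMoment, sq]

theorem secondMoment_mem (ν : Measure I) [IsProbabilityMeasure ν] :
    secondMoment ν ∈ Set.Icc (0 : ℝ) 1 := by
  rw [secondMoment_eq]
  exact integral_unitInterval_mem (by fun_prop)

theorem integrable_sq (ν : Measure I) [IsProbabilityMeasure ν] :
    Integrable (fun x : I => (x : ℝ) ^ 2) ν := by
  simpa [sq] using integrable_unitInterval (P := ν) (X := fun x => x * x) (by fun_prop)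

theorem secondMoment_le_mean (ν : Measure I) [IsProbabilityMeasure ν] :
    secondMoment ν ≤ mean ν :=
  integral_mono (integrable_sq ν) (integrable_unitInterval measurable_id) fun x => by
    have h0 := x.2.1
    have h1 := x.2.2
    change (x : ℝ) ^ 2 ≤ x
    nlinarith

theorem integral_const_sub_mul_add {Ω : Type*} [MeasurableSpace Ω] {P : Measure Ω}
    [IsProbabilityMeasure P] {f g : Ω → ℝ} (hf : Integrable f P) (hg : Integrable g P) (a b : ℝ) :
    ∫ ω, (a - b * f ω + g ω) ∂P = a - b * ∫ ω, f ω ∂P + ∫ ω, g ω ∂P := by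
  have h1 : Integrable (fun ω => b * f ω) P := hf.const_mul b
  have h2 : Integrable (fun ω => a - b * f ω) P := (integrable_const a).sub h1
  rw [integral_add h2 hg, integral_sub (integrable_const a) h1, integral_const_mul]
  simp

theorem integral_sub_sq (ν : Measure I) [IsProbabilityMeasure ν] (c : ℝ) :
    ∫ x, ((x : ℝ) - c) ^ 2 ∂ν = secondMoment ν - 2 * c * mean ν + c ^ 2 := by
  have h : ∀ x : I, ((x : ℝ) - c) ^ 2 = c ^ 2 - 2 * c * x + (x : ℝ) ^ 2 := fun x => by ring
  simp only [h]
  rw [integral_const_sub_mul_add (f := fun x : I => (x : ℝ)) (integrable_unitInterval measurable_id)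
    (integrable_sq ν), secondMoment, mean]
  ring

theorem sq_mean_le_secondMoment (ν : Measure I) [IsProbabilityMeasure ν] :
    mean ν ^ 2 ≤ secondMoment ν := by
  have h := integral_sub_sq ν (mean ν)
  have h2 : 0 ≤ ∫ x, ((x : ℝ) - mean ν) ^ 2 ∂ν := integral_nonneg fun x => sq_nonneg _
  nlinarith

/-- At `t = 1` the value `⊤` contributes its mass to the integral but not to `pgf`; the alternative
in `ht` excludes this discrepancy. -/
theorem integral_liveProd_const (t : I) (ht : t ≠ 1 ∨ d {⊤} = 0) :
    ∫ n, (liveProd n (fun _ => t) : ℝ) ∂d = pgf d t := by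
  have hi : Integrable (fun n : ℕ∞ => (liveProd n (fun _ => t) : ℝ)) d :=
    integrable_unitInterval (measurable_of_countable _)
  rw [integral_countable hi, pgf, ← Function.Injective.tsum_eq (g := fun n : ℕ => (n : ℕ∞))
    Nat.cast_injective]
  · refine tsum_congr fun n => ?_
    simp [liveProd_coe]
  · intro n hn
    rcases eq_or_ne n ⊤ with rfl | h
    · refine absurd ?_ hn
      rcases ht with ht | ht
      · simp [liveProd_top_const ht]
      · simp [Measure.real, ht]
    · lift n to ℕ using h
      exact ⟨n, rfl⟩

/-- Expand `(1 - ∏ Xᵢ)² = 1 - 2 ∏ Xᵢ + ∏ Xᵢ²`; both products have independent factors. The first two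
moments therefore form a closed system. -/
theorem integral_vetoStep_sq {Ω : Type*} [MeasurableSpace Ω] {P : Measure Ω}
    [IsProbabilityMeasure P] {X : ℕ → Ω → I} (hX : ∀ i, Measurable (X i))
    (hind : iIndepFun X P) (n : ℕ∞) (m s : I) (hm : ∀ i, ∫ ω, (X i ω : ℝ) ∂P = m)
    (hs : ∀ i, ∫ ω, (X i ω : ℝ) ^ 2 ∂P = s) :
    ∫ ω, (vetoStep n (fun i => X i ω) : ℝ) ^ 2 ∂P =
      1 - 2 * liveProd n (fun _ => m) + liveProd n (fun _ => s) := by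
  have h1 := integral_liveProd hX hind n (fun _ => m) hm
  have h2 := integral_liveProd (X := fun i ω => X i ω * X i ω) (fun i => (hX i).mul (hX i))
    (hind.comp (fun _ x => x * x) fun _ => by fun_prop) n (fun _ => s)
    (fun i => by rw [← hs i]; simp [sq])
  have e : ∀ ω, (vetoStep n (fun i => X i ω) : ℝ) ^ 2 =
      1 - 2 * (liveProd n (fun i => X i ω) : ℝ) + liveProd n (fun i => X i ω * X i ω) := by
    intro ω
    rw [liveProd_mul, vetoStep, unitInterval.coe_symm_eq, Set.Icc.coe_mul]
    ring
  simp only [e]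
  have i1 := integrable_unitInterval (P := P) (measurable_const.liveProd (n := fun _ => n) hX)
  have i2 := integrable_unitInterval (P := P) (measurable_const.liveProd (n := fun _ => n)
    (x := fun i ω => X i ω * X i ω) fun i => (hX i).mul (hX i))
  rw [integral_const_sub_mul_add i1 i2, h1, h2]

theorem iIndepFun_eval_infinitePi (ν : Measure I) [IsProbabilityMeasure ν] :
    iIndepFun (fun (i : ℕ) (x : ℕ → I) => x i) (Measure.infinitePi fun _ : ℕ => ν) :=
  iIndepFun_infinitePi (X := fun _ x => x) fun _ => measurable_id

theorem integral_eval_infinitePi (ν : Measure I) [IsProbabilityMeasure ν] (i : ℕ) (f : I → ℝ)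
    (hf : Measurable f) :
    ∫ x : ℕ → I, f (x i) ∂(Measure.infinitePi fun _ : ℕ => ν) = ∫ x, f x ∂ν := by
  have h := integral_map (μ := Measure.infinitePi fun _ : ℕ => ν) (φ := fun x => x i)
    (measurable_pi_apply i).aemeasurable (f := f) (by fun_prop)
  rw [← h, Measure.infinitePi_map_eval]

theorem mean_stepLaw (h : mean ν ≠ 1 ∨ d {⊤} = 0) :
    mean (stepLaw d ν) = 1 - pgf d (mean ν) := by
  rw [stepLaw, mean_map measurable_vetoStep_prod,
    integral_prod _ (integrable_unitInterval measurable_vetoStep_prod)]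
  have e : ∀ n : ℕ∞, ∫ x : ℕ → I, (vetoStep n x : ℝ) ∂(Measure.infinitePi fun _ : ℕ => ν) =
      vetoStep n (fun _ => ⟨mean ν, mean_mem ν⟩) := fun n =>
    integral_vetoStep (X := fun i (x : ℕ → I) => x i) (fun i => measurable_pi_apply i)
      (iIndepFun_eval_infinitePi ν) n _
      fun i => integral_eval_infinitePi ν i (fun x => x) (by fun_prop)
  simp only [e]
  unfold vetoStep
  rw [integral_symm (measurable_of_countable _), integral_liveProd_const]
  exact h.imp_left fun h h' => h (congrArg Subtype.val h')

theorem secondMoment_stepLaw (h : mean ν ≠ 1 ∨ d {⊤} = 0) :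
    secondMoment (stepLaw d ν) = 1 - 2 * pgf d (mean ν) + pgf d (secondMoment ν) := by
  have hs : secondMoment ν ≠ 1 ∨ d {⊤} = 0 := h.imp_left fun h h' =>
    h (le_antisymm (mean_mem ν).2 (h' ▸ secondMoment_le_mean ν))
  rw [stepLaw, secondMoment_map measurable_vetoStep_prod, integral_prod]
  · have e : ∀ n : ℕ∞, ∫ x : ℕ → I, (vetoStep n x : ℝ) ^ 2 ∂(Measure.infinitePi fun _ : ℕ => ν) =
        1 - 2 * liveProd n (fun _ => (⟨mean ν, mean_mem ν⟩ : I)) +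
          liveProd n (fun _ => (⟨secondMoment ν, secondMoment_mem ν⟩ : I)) := fun n =>
      integral_vetoStep_sq (X := fun i (x : ℕ → I) => x i) (fun i => measurable_pi_apply i)
        (iIndepFun_eval_infinitePi ν) n _ _
        (fun i => integral_eval_infinitePi ν i (fun x => x) (by fun_prop))
        fun i => integral_eval_infinitePi ν i (fun x => (x : ℝ) ^ 2) (by fun_prop)
    simp only [e]
    have i1 : ∀ t : I, Integrable (fun n : ℕ∞ => (liveProd n (fun _ => t) : ℝ)) d := fun t =>
      integrable_unitInterval (measurable_of_countable _)
    rw [integral_const_sub_mul_add (i1 _) (i1 _),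
      integral_liveProd_const _ (h.imp_left fun h h' => h (congrArg Subtype.val h')),
      integral_liveProd_const _ (hs.imp_left fun h h' => h (congrArg Subtype.val h'))]
  · simpa [sq] using integrable_unitInterval
      (P := d.prod (Measure.infinitePi fun _ : ℕ => ν))
      (X := fun p => vetoStep p.1 p.2 * vetoStep p.1 p.2)
      (measurable_vetoStep_prod.mul measurable_vetoStep_prod)

end StepLaw

/-! ### The recursion over several generations, and conditioning on the tree. -/

/-- The value at `u` obtained from the values `z` at distance `m` below `u` by applying the
recursion along the tree `t`. -/
noncomputable def unroll (t : Node → ℕ∞) (z : Node → I) : ℕ → Node → I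
  | 0, u => z u
  | m + 1, u => vetoStep (t u) fun i => unroll t z m (u ++ [i])

theorem unroll_congr {t t' : Node → ℕ∞} {z z' : Node → I} {m : ℕ} {u : Node}
    (ht : ∀ v, v.length < u.length + m → t v = t' v)
    (hz : ∀ v, v.length = u.length + m → z v = z' v) :
    unroll t z m u = unroll t' z' m u := by
  induction m generalizing u with
  | zero => exact hz u rfl
  | succ m ih =>
    simp only [unroll]
    rw [ht u (by omega)]
    congr 1
    funext i
    exact ih (fun v hv => ht v (by simp at hv; omega)) fun v hv => hz v (by simp at hv; omega)

theorem unroll_of_eq {t : Node → ℕ∞} {z : Node → I}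
    (h : ∀ v, z v = vetoStep (t v) fun i => z (v ++ [i])) (m : ℕ) (u : Node) :
    unroll t z m u = z u := by
  induction m generalizing u with
  | zero => rfl
  | succ m ih =>
    simp only [unroll, ih]
    exact (h u).symm

/-- The definition peels off the root; peeling off the deepest generation instead lets an induction
replace the labels of one generation by those of the generation above. -/
theorem unroll_succ' (t : Node → ℕ∞) (z : Node → I) (m : ℕ) (u : Node) :
    unroll t z (m + 1) u = unroll t (fun v => vetoStep (t v) fun i => z (v ++ [i])) m u := by
  induction m generalizing u with
  | zero => rfl
  | succ m ih =>
    rw [unroll]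
    simp only [ih]
    rfl

theorem Measurable.unroll {Ω : Type*} {_ : MeasurableSpace Ω} {N : Node → Ω → ℕ∞}
    {X : Node → Ω → I} {m : ℕ} {u : Node} (hN : ∀ w, Measurable (N (u ++ w)))
    (hX : ∀ w, Measurable (X (u ++ w))) :
    Measurable fun ω => unroll (fun v => N v ω) (fun v => X v ω) m u := by
  induction m generalizing u with
  | zero => simpa [_root_.unroll] using hX []
  | succ m ih =>
    simp only [_root_.unroll]
    refine Measurable.vetoStep (by simpa using hN []) fun i => ih (fun w => ?_) fun w => ?_
    · simpa using hN ([i] ++ w)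
    · simpa using hX ([i] ++ w)

/-- On a frozen tree the labels one generation higher are functions of disjoint sets of daughters,
so they are again independent, and expectation passes through one step at a time. -/
theorem integral_unroll {Ω : Type*} [MeasurableSpace Ω] {P : Measure Ω} [IsProbabilityMeasure P]
    (t : Node → ℕ∞) {X : Node → Ω → I} (hX : ∀ v, Measurable (X v)) {n m : ℕ} {u : Node}
    (hn : u.length + m = n) (hind : iIndepFun (fun v : {v : Node // v.length = n} => X v) P)
    {c : Node → I} (hc : ∀ v, v.length = n → ∫ ω, (X v ω : ℝ) ∂P = c v) :
    ∫ ω, (unroll t (fun v => X v ω) m u : ℝ) ∂P = unroll t c m u := by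
  induction m generalizing n X c with
  | zero => exact hc u hn
  | succ m ih =>
    simp only [unroll_succ']
    have hchild : ∀ v : {v : Node // v.length = u.length + m},
        iIndepFun (fun i => X (v.1 ++ [i])) P := fun v =>
      hind.precomp (g := fun i : ℕ => (⟨v.1 ++ [i], by simp [v.2, ← hn, add_assoc]⟩ :
        {v : Node // v.length = n})) fun i j h => by simpa using h
    refine ih (X := fun v ω => vetoStep (t v) fun i => X (v ++ [i]) ω)
      (fun v => measurable_const.vetoStep fun i => hX _) rfl ?_ fun v hv => ?_
    · refine iIndepFun_of_biSup (S := fun v => {w : {v : Node // v.length = n} |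
        ∃ i, w.1 = v.1 ++ [i]}) (fun w => (hX w.1).comap_le) hind.iIndep ?_ fun v => ?_
      · intro v v' hvv
        refine Set.disjoint_left.2 ?_
        rintro w ⟨i, hi⟩ ⟨j, hj⟩
        rw [hi] at hj
        exact hvv (Subtype.ext (List.append_inj_left' hj rfl))
      · refine measurable_const.vetoStep fun i => ?_
        exact measurable_biSup_comap (X := fun w : {v : Node // v.length = n} => X w.1)
          (i := ⟨v.1 ++ [i], by simp [v.2, ← hn, add_assoc]⟩) ⟨i, rfl⟩
    · exact integral_vetoStep (fun i => hX _) (hchild ⟨v, hv⟩) _ _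
        fun i => hc _ (by simp [hv, ← hn, add_assoc])

/-- By independence the conditional distribution of `B` given `A` is the constant kernel, so
conditioning freezes `A` and integrates out `B`. -/
theorem condExp_comp_of_indepFun {Ω α β : Type*} [MeasurableSpace Ω] [mα : MeasurableSpace α]
    [MeasurableSpace β] [StandardBorelSpace β] [Nonempty β] {P : Measure Ω}
    [IsProbabilityMeasure P]
    {A : Ω → α} {B : Ω → β} (hA : Measurable A) (hB : Measurable B) (hAB : IndepFun A B P)
    {F : α × β → I} (hF : Measurable F) :
    P[fun ω => (F (A ω, B ω) : ℝ) | mα.comap A] =ᵐ[P]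
      fun ω => ∫ ω', (F (A ω, B ω') : ℝ) ∂P := by
  have hF' : Measurable fun p => (F p : ℝ) := measurable_subtype_coe.comp hF
  have h1 := condExp_prod_ae_eq_integral_condDistrib (μ := P) hA hB.aemeasurable
    (f := fun p => (F p : ℝ)) hF'.stronglyMeasurable
    (integrable_unitInterval (hF.comp (hA.prodMk hB)))
  have := Measure.isProbabilityMeasure_map (μ := P) hB.aemeasurable
  have h2 : condDistrib B A P =ᵐ[P.map A] Kernel.const α (P.map B) := by
    refine condDistrib_ae_eq_of_measure_eq_compProd A hB.aemeasurable ?_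
    rw [Measure.compProd_const]
    exact (indepFun_iff_map_prod_eq_prod_map_map hA.aemeasurable hB.aemeasurable).1 hAB
  filter_upwards [h1, ae_of_ae_map hA.aemeasurable h2] with ω h1 h2
  rw [h1, h2, Kernel.const_apply, integral_map hB.aemeasurable]
  exact (hF'.comp measurable_prodMk_left).aestronglyMeasurable

section Tree

variable {Ω : Type*} {mΩ : MeasurableSpace Ω} {P : Measure Ω}

theorem Measurable.of_eval {Ω ι : Type*} {β : ι → Type*} {_ : MeasurableSpace Ω}
    [∀ i, MeasurableSpace (β i)] {f : Ω → ∀ i, β i} (h : ∀ i, Measurable fun ω => f ω i) :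
    Measurable f := measurable_pi_iff.2 h

/-- The filtration `σ(N u; |u| < n)`. -/
def treeFiltration (N : Node → Ω → ℕ∞) (hN : ∀ u, Measurable (N u)) : Filtration ℕ mΩ where
  seq n := ⨆ u ∈ {u : Node | u.length < n}, MeasurableSpace.comap (N u) inferInstance
  mono' _ _ h := biSup_mono fun _ hu => lt_of_lt_of_le hu h
  le' _ := iSup₂_le fun u _ => (hN u).comap_le

theorem iSup_treeFiltration (N : Node → Ω → ℕ∞) (hN : ∀ u, Measurable (N u)) :
    ⨆ n, treeFiltration N hN n = treeSigma N := by
  refine le_antisymm (iSup_le fun n => iSup₂_le fun u _ => le_iSup_of_le u le_rfl)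
    (iSup_le fun u => ?_)
  refine le_iSup_of_le (u.length + 1) ?_
  exact le_iSup₂_of_le (f := fun u (_ : u ∈ {v : Node | v.length < _}) =>
    MeasurableSpace.comap (N u) _) u (Nat.lt_succ_self _) le_rfl

theorem treeFiltration_eq_comap (N : Node → Ω → ℕ∞) (hN : ∀ u, Measurable (N u)) (n : ℕ) :
    treeFiltration N hN n = MeasurableSpace.comap
      (fun ω (v : {v : Node // v.length < n}) => N v.1 ω) inferInstance := by
  refine le_antisymm (iSup₂_le fun u hu => ?_) ?_
  · exact ((measurable_pi_apply (⟨u, hu⟩ : {v : Node // v.length < n})).comp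
      (comap_measurable fun ω (v : {v : Node // v.length < n}) => N v.1 ω)).comap_le
  · refine Measurable.comap_le (Measurable.of_eval fun v => ?_)
    exact measurable_biSup_comap (S := {u : Node | u.length < n}) v.2

/-- Given the first `n` generations of the tree, a solution of the recursion whose values in
generation `n` are independent with mean `c` and independent of these generations is on average
what the recursion makes of the constant `c`. -/
theorem condExp_eq_unroll [IsProbabilityMeasure P] {N : Node → Ω → ℕ∞}
    (hN : ∀ u, Measurable (N u)) {Z : Node → Ω → I} (hZ : ∀ u, Measurable (Z u))
    (heq : ∀ᵐ ω ∂P, ∀ v, Z v ω = vetoStep (N v ω) fun i => Z (v ++ [i]) ω) {n m : ℕ} {u : Node}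
    (hn : u.length + m = n) (hind : iIndepFun (fun v : {v : Node // v.length = n} => Z v) P)
    (htree : IndepFun (fun ω (v : {v : Node // v.length = n}) => Z v.1 ω)
      (fun ω (v : {v : Node // v.length < n}) => N v.1 ω) P)
    {c : I} (hc : ∀ v, v.length = n → ∫ ω, (Z v ω : ℝ) ∂P = c) :
    P[fun ω => (Z u ω : ℝ) | treeFiltration N hN n] =ᵐ[P]
      fun ω => (unroll (fun v => N v ω) (fun _ => c) m u : ℝ) := by
  classical
  rw [treeFiltration_eq_comap]
  let A : Ω → ({v : Node // v.length < n} → ℕ∞) := fun ω v => N v.1 ω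
  let B : Ω → ({v : Node // v.length = n} → I) := fun ω v => Z v.1 ω
  have hA : Measurable A := measurable_pi_lambda _ fun v => hN _
  have hB : Measurable B := measurable_pi_lambda _ fun v => hZ _
  -- The defaults 0 are never read: unrolling `m` steps from `u` uses only sizes before generation
  -- `n` and labels in generation `n`.
  let F : ({v : Node // v.length < n} → ℕ∞) × ({v : Node // v.length = n} → I) → I := fun p =>
    unroll (fun v => if h : v.length < n then p.1 ⟨v, h⟩ else 0)
      (fun v => if h : v.length = n then p.2 ⟨v, h⟩ else 0) m u
  have hF : Measurable F := by
    refine Measurable.unroll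
      (N := fun v (p : ({v : Node // v.length < n} → ℕ∞) × ({v : Node // v.length = n} → I)) =>
        if h : v.length < n then p.1 ⟨v, h⟩ else 0)
      (X := fun v (p : ({v : Node // v.length < n} → ℕ∞) × ({v : Node // v.length = n} → I)) =>
        if h : v.length = n then p.2 ⟨v, h⟩ else 0) (fun w => ?_) fun w => ?_
    · by_cases h : (u ++ w).length < n
      · simp only [h, dif_pos]
        exact (measurable_pi_apply _).comp measurable_fst
      · simp only [h, dif_neg, not_false_eq_true, measurable_const]
    · by_cases h : (u ++ w).length = n
      · simp only [h, dif_pos]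
        exact (measurable_pi_apply _).comp measurable_snd
      · simp only [h, dif_neg, not_false_eq_true, measurable_const]
  have hFeq : ∀ ω ω', F (A ω, B ω') = unroll (fun v => N v ω) (fun v => Z v ω') m u := by
    intro ω ω'
    refine unroll_congr (fun v hv => ?_) fun v hv => ?_
    · exact dif_pos (hn ▸ hv)
    · exact dif_pos (hn ▸ hv)
  have h1 := condExp_comp_of_indepFun hA hB htree.symm hF
  have h2 : (fun ω => (Z u ω : ℝ)) =ᵐ[P] fun ω => (F (A ω, B ω) : ℝ) := by
    filter_upwards [heq] with ω hω
    rw [hFeq, unroll_of_eq hω]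
  refine (condExp_congr_ae h2).trans (h1.trans (ae_of_all _ fun ω => ?_))
  simp only [hFeq]
  exact integral_unroll _ hZ hn hind hc

/-- The process on all generations with given values in the even ones, extended to the odd ones
by the recursion. -/
noncomputable def extendOdd (N : Node → Ω → ℕ∞) (X : EvenNode → Ω → I) (v : Node) (ω : Ω) : I :=
  if h : Even v.length then X ⟨v, h⟩ ω
  else vetoStep (N v ω) fun i => X ⟨v ++ [i], by
    rw [List.length_append]; exact (Nat.not_even_iff_odd.1 h).add_odd odd_one⟩ ω

theorem extendOdd_even (N : Node → Ω → ℕ∞) (X : EvenNode → Ω → I) (u : EvenNode) :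
    extendOdd N X u.1 = X u := by
  funext ω
  exact dif_pos u.2

theorem measurable_extendOdd {N : Node → Ω → ℕ∞} (hN : ∀ u, Measurable (N u))
    {X : EvenNode → Ω → I} (hX : ∀ u, Measurable (X u)) (v : Node) :
    Measurable (extendOdd N X v) := by
  by_cases h : Even v.length
  · exact (extendOdd_even N X ⟨v, h⟩) ▸ hX _
  · unfold extendOdd
    simp only [h, dif_neg, not_false_eq_true]
    exact (hN v).vetoStep fun i => hX _

/-- Filling in the odd generations makes the one-step recursion hold everywhere: by definition at
odd vertices, and by the iterated equation at even ones. -/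
theorem IsTreeSolution.extendOdd_equation {N : Node → Ω → ℕ∞} {X : EvenNode → Ω → I}
    (h : IsTreeSolution P N X) :
    ∀ᵐ ω ∂P, ∀ v, extendOdd N X v ω =
      vetoStep (N v ω) fun i => extendOdd N X (v ++ [i]) ω := by
  filter_upwards [ae_all_iff.2 h.equation] with ω hω v
  by_cases hv : Even v.length
  · have hodd : ∀ i, ¬ Even (v ++ [i]).length := fun i => by
      rw [List.length_append, Nat.not_even_iff_odd]; exact hv.add_odd odd_one
    rw [extendOdd_even N X ⟨v, hv⟩, hω ⟨v, hv⟩, iterStep_eq]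
    congr 1
    funext i
    simp only [extendOdd, hodd, dif_neg, not_false_eq_true]
    congr 1
    funext j
    congr 2
    simp [EvenNode.grandchild]
  · rw [extendOdd, dif_neg hv]
    congr 1
    funext i
    exact (congrFun (extendOdd_even N X ⟨v ++ [i], _⟩) ω).symm

/-- The values that the recursion makes of the constant `c` in generation `2n`. -/
noncomputable def cutoff (c : I) (t : Node → ℕ∞) (n : ℕ) (u : Node) : I :=
  unroll t (fun _ => c) (2 * n - u.length) u

theorem cutoff_of_le (c : I) (t : Node → ℕ∞) {n : ℕ} {u : Node} (h : 2 * n ≤ u.length) :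
    cutoff c t n u = c := by
  -- Truncated subtraction leaves zero steps to unroll from generation `2n` on.
  simp [cutoff, Nat.sub_eq_zero_of_le h, unroll]

theorem cutoff_of_lt (c : I) (t : Node → ℕ∞) {n : ℕ} {u : Node} (h : u.length < 2 * n) :
    cutoff c t n u = vetoStep (t u) fun i => cutoff c t n (u ++ [i]) := by
  obtain ⟨k, hk⟩ : ∃ k, 2 * n - u.length = k + 1 := ⟨2 * n - u.length - 1, by omega⟩
  rw [cutoff, hk, unroll]
  congr 1
  funext i
  rw [cutoff, List.length_append, List.length_singleton, show 2 * n - (u.length + 1) = k by omega]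

theorem IsTreeSolution.condExp_eq [IsProbabilityMeasure P] {N : Node → Ω → ℕ∞}
    (hN : ∀ u, Measurable (N u)) {X : EvenNode → Ω → I}
    (h : IsTreeSolution P N X) {c : I} (hc : ∀ u, mean (P.map (X u)) = c) {n : ℕ} {u : Node}
    (hn : u.length ≤ 2 * n) :
    P[fun ω => (extendOdd N X u ω : ℝ) | treeFiltration N hN (2 * n)] =ᵐ[P]
      fun ω => (cutoff c (fun v => N v ω) n u : ℝ) := by
  have hev : ∀ v : {v : Node // v.length = 2 * n}, Even v.1.length := fun v => by
    rw [v.2]; exact even_two_mul n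
  have hlev : ∀ v : {v : Node // v.length = 2 * n}, extendOdd N X v =
      X ⟨v.1, hev v⟩ := fun v => extendOdd_even N X ⟨v.1, hev v⟩
  refine condExp_eq_unroll hN (measurable_extendOdd hN h.measurable) h.extendOdd_equation
    (by omega) ?_ ?_ fun v hv => ?_
  · simp only [hlev]
    exact (h.indep n).precomp (g := fun v : {v : Node // v.length = 2 * n} =>
      (⟨⟨v.1, hev v⟩, v.2⟩ : {u : EvenNode // u.1.length = 2 * n}))
      fun a b hab => by simpa [Subtype.ext_iff] using hab
  · simp only [hlev]
    exact (h.indep_tree n).comp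
      (φ := fun (x : {u : EvenNode // u.1.length = 2 * n} → I)
        (v : {v : Node // v.length = 2 * n}) => x ⟨⟨v.1, hev v⟩, v.2⟩)
      (by fun_prop) measurable_id
  · rw [hlev ⟨v, hv⟩, ← hc ⟨v, hev ⟨v, hv⟩⟩, mean_map (h.measurable _)]

/-- A tree-indexed solution is on average, given the tree, the limit of the cut-off recursion. -/
theorem IsTreeSolution.tendsto_cutoff [IsProbabilityMeasure P] {N : Node → Ω → ℕ∞}
    (hN : ∀ u, Measurable (N u)) {X : EvenNode → Ω → I}
    (h : IsTreeSolution P N X) {c : I} (hc : ∀ u, mean (P.map (X u)) = c) (u : Node) :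
    ∀ᵐ ω ∂P, Tendsto (fun n => (cutoff c (fun v => N v ω) n u : ℝ)) atTop
      (𝓝 ((P[fun ω => (extendOdd N X u ω : ℝ) | treeSigma N]) ω)) := by
  -- Lévy's upward theorem; the result is then read along the even generations.
  have h1 := tendsto_ae_condExp (μ := P) (ℱ := treeFiltration N hN)
    (fun ω => (extendOdd N X u ω : ℝ))
  rw [iSup_treeFiltration] at h1
  have h2 : ∀ᵐ ω ∂P, ∀ n, u.length ≤ 2 * n →
      (P[fun ω => (extendOdd N X u ω : ℝ) | treeFiltration N hN (2 * n)]) ω =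
        (cutoff c (fun v => N v ω) n u : ℝ) := by
    refine ae_all_iff.2 fun n => ?_
    by_cases hn : u.length ≤ 2 * n
    · filter_upwards [h.condExp_eq hN hc hn] with ω hω _ using hω
    · exact ae_of_all _ fun ω h => absurd h hn
  filter_upwards [h1, h2] with ω hω1 hω2
  refine (hω1.comp (tendsto_id.const_mul_atTop' two_pos)).congr' ?_
  filter_upwards [eventually_ge_atTop u.length] with n hn
  exact hω2 n (by omega)

end Tree

/-! ### Construction of labelled trees as inverse limits. -/

/-- An inverse sequence of standard Borel probability spaces has a limit. -/
theorem exists_inverseLimit {W : Type} [MeasurableSpace W] [StandardBorelSpace W] [Nonempty W]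
    (Q : ℕ → Measure W) [∀ n, IsProbabilityMeasure (Q n)] {f : ℕ → W → W}
    (hf : ∀ n, Measurable (f n)) (hQ : ∀ n, (Q (n + 1)).map (f n) = Q n) :
    ∃ P : Measure (ℕ → W), IsProbabilityMeasure P ∧ (∀ n, P.map (fun ω => ω n) = Q n) ∧
      ∀ᵐ ω ∂P, ∀ n, f n (ω (n + 1)) = ω n := by
  -- The transition from coordinate `n` is the conditional law, under `Q (n + 1)`, of a point given
  -- its image under `f n`. Ionescu-Tulcea then produces the trajectory measure.
  let κ : (n : ℕ) → Kernel (Π _ : Finset.Iic n, W) W := fun n =>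
    (condDistrib id (f n) (Q (n + 1))).comap (fun x => x ⟨n, Finset.mem_Iic.2 le_rfl⟩)
      (measurable_pi_apply _)
  have : ∀ n, IsMarkovKernel (κ n) := fun n => by dsimp only [κ]; infer_instance
  let P : Measure (ℕ → W) := Kernel.trajMeasure (X := fun _ => W) (Q 0) κ
  have hP : IsProbabilityMeasure P := by dsimp only [P]; infer_instance
  -- Disintegration: a correct marginal at `n` followed by the conditional law makes consecutive
  -- coordinates distributed as `(f n w, w)`, which gives both the next marginal and compatibility.
  have hpair : ∀ n, P.map (fun ω => ω n) = Q n →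
      P.map (fun ω => (ω n, ω (n + 1))) = (Q (n + 1)).map fun w => (f n w, w) := by
    intro n hn
    have h1 := Kernel.map_frestrictLe_trajMeasure_compProd_eq_map_trajMeasure
      (X := fun _ => W) (μ₀ := Q 0) (κ := κ) (a := n)
    have h2 := congrArg (fun μ => μ.map (fun p : (Π _ : Finset.Iic n, W) × W =>
      (p.1 ⟨n, Finset.mem_Iic.2 le_rfl⟩, p.2))) h1
    rw [Measure.map_map (by fun_prop) (by fun_prop)] at h2
    have h3 := compProd_map_condDistrib (mβ := inferInstance) (X := f n) (Y := (id : W → W)) (μ := Q (n + 1))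
      measurable_id.aemeasurable
    rw [hQ, ← hn] at h3
    refine h2.symm.trans (Eq.trans ?_ h3)
    ext s hs
    have hs' : MeasurableSet ((fun p : (Π _ : Finset.Iic n, W) × W =>
        (p.1 ⟨n, Finset.mem_Iic.2 le_rfl⟩, p.2)) ⁻¹' s) := hs.preimage (by fun_prop)
    rw [Measure.map_apply (by fun_prop) hs, Measure.compProd_apply hs,
      Measure.compProd_apply hs',
      lintegral_map (Kernel.measurable_kernel_prodMk_left hs') (by fun_prop),
      lintegral_map (Kernel.measurable_kernel_prodMk_left hs) (by fun_prop)]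
    rfl
  have hmarg : ∀ n, P.map (fun ω => ω n) = Q n := by
    intro n
    induction n with
    | zero =>
      have h0 : P.map (Preorder.frestrictLe (π := fun _ => W) 0) =
          (Q 0).map (MeasurableEquiv.piUnique (fun _ : Finset.Iic 0 => W)).symm := by
        dsimp only [P]
        rw [Kernel.trajMeasure, Measure.map_comp _ _ (by fun_prop), Kernel.traj_map_frestrictLe,
          Kernel.partialTraj_self, Measure.id_comp]
      have h1 := congrArg (fun μ => μ.map (fun p : (Π _ : Finset.Iic 0, W) =>
        p ⟨0, Finset.mem_Iic.2 le_rfl⟩)) h0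
      rw [Measure.map_map (by fun_prop) (by fun_prop),
        Measure.map_map (by fun_prop) (by fun_prop)] at h1
      exact h1.trans Measure.map_id
    | succ n ih =>
      have h1 := congrArg (fun μ => μ.map Prod.snd) (hpair n ih)
      rw [Measure.map_map (by fun_prop) (by fun_prop),
        Measure.map_map measurable_snd
          (show Measurable fun w => (f n w, w) from (hf n).prodMk measurable_id)] at h1
      exact h1.trans Measure.map_id
  refine ⟨P, hP, hmarg, ae_all_iff.2 fun n => ?_⟩
  have hs : MeasurableSet {p : W × W | f n p.2 = p.1} :=
    measurableSet_eq_fun ((hf n).comp measurable_snd) measurable_fst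
  have h1 : ∀ᵐ p ∂(P.map fun ω => (ω n, ω (n + 1))), f n p.2 = p.1 := by
    rw [hpair n (hmarg n)]
    refine (ae_map_iff ((hf n).prodMk measurable_id).aemeasurable hs).2 ?_
    exact ae_of_all _ fun w => rfl
  exact (ae_map_iff (by fun_prop) hs).1 h1

section Level

variable {Ω : Type*} {mΩ : MeasurableSpace Ω} {P : Measure Ω} {d : Measure ℕ∞} {ν : Measure I}
  {n : ℕ} {T : Node → Ω → ℕ∞} {Y : Node → Ω → I}

/-- The law of a tree with independent family sizes of law `d` before generation `n`, and
independent labels of law `ν` in generation `n`. -/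
noncomputable def levelLaw (d : Measure ℕ∞) (ν : Measure I) (n : ℕ) :
    Measure (({v : Node // v.length < n} → ℕ∞) × ({v : Node // v.length = n} → I)) :=
  (Measure.infinitePi fun _ => d).prod (Measure.infinitePi fun _ => ν)

instance [IsProbabilityMeasure d] [IsProbabilityMeasure ν] :
    IsProbabilityMeasure (levelLaw d ν n) := by
  unfold levelLaw; infer_instance

/-- The first `n` generations of a labelled tree. -/
def levelRestrict (n : ℕ) (p : (Node → ℕ∞) × (Node → I)) :
    ({v : Node // v.length < n} → ℕ∞) × ({v : Node // v.length = n} → I) :=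
  (fun v => p.1 v, fun v => p.2 v)

/-- The extension by zero of the first `n` generations of a labelled tree. -/
def levelExtend (n : ℕ) (p : ({v : Node // v.length < n} → ℕ∞) × ({v : Node // v.length = n} → I)) :
    (Node → ℕ∞) × (Node → I) :=
  (fun v => if h : v.length < n then p.1 ⟨v, h⟩ else 0,
    fun v => if h : v.length = n then p.2 ⟨v, h⟩ else 0)

theorem measurable_levelRestrict : Measurable (levelRestrict n) := by
  unfold levelRestrict; fun_prop

theorem measurable_levelExtend : Measurable (levelExtend n) := by
  refine Measurable.prodMk (Measurable.of_eval fun v => ?_) (Measurable.of_eval fun v => ?_)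
  · by_cases h : v.length < n
    · simp only [h, dif_pos]; fun_prop
    · simp only [h, dif_neg, not_false_eq_true, measurable_const]
  · by_cases h : v.length = n
    · simp only [h, dif_pos]; fun_prop
    · simp only [h, dif_neg, not_false_eq_true, measurable_const]

theorem levelRestrict_levelExtend
    (p : ({v : Node // v.length < n} → ℕ∞) × ({v : Node // v.length = n} → I)) :
    levelRestrict n (levelExtend n p) = p := by
  refine Prod.ext (funext fun v => dif_pos v.2) (funext fun v => dif_pos v.2)

/-- The family sizes `T` before generation `n` and the labels `Y` in generation `n` are all
independent, with laws `d` and `ν`. -/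
structure IsLevel (P : Measure Ω) (d : Measure ℕ∞) (ν : Measure I) (n : ℕ) (T : Node → Ω → ℕ∞)
    (Y : Node → Ω → I) : Prop where
  measurable_size : ∀ v, Measurable (T v)
  measurable_label : ∀ v, Measurable (Y v)
  map_eq : P.map (fun ω => levelRestrict n (fun v => T v ω, fun v => Y v ω)) = levelLaw d ν n

theorem IsLevel.measurable (h : IsLevel P d ν n T Y) :
    Measurable fun ω => ((fun v => T v ω, fun v => Y v ω) : (Node → ℕ∞) × (Node → I)) :=
  (Measurable.of_eval h.measurable_size).prodMk (Measurable.of_eval h.measurable_label)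

theorem IsLevel.of_indep [IsProbabilityMeasure P] (hT : ∀ v, Measurable (T v)) (hY : ∀ v, Measurable (Y v))
    (hTd : ∀ v, v.length < n → P.map (T v) = d) (hYν : ∀ v, v.length = n → P.map (Y v) = ν)
    (hTi : iIndepFun (fun v : {v : Node // v.length < n} => T v) P)
    (hYi : iIndepFun (fun v : {v : Node // v.length = n} => Y v) P)
    (h : IndepFun (fun ω (v : {v : Node // v.length = n}) => Y v ω)
      (fun ω (v : {v : Node // v.length < n}) => T v ω) P) : IsLevel P d ν n T Y := by
  refine ⟨hT, hY, ?_⟩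
  refine ((indepFun_iff_map_prod_eq_prod_map_map
    (Measurable.of_eval fun v => hT _).aemeasurable
    (Measurable.of_eval fun v => hY _).aemeasurable).1 h.symm).trans ?_
  rw [(iIndepFun_iff_map_fun_eq_infinitePi_map fun v => hT _).1 hTi,
    (iIndepFun_iff_map_fun_eq_infinitePi_map fun v => hY _).1 hYi, levelLaw]
  congr 2
  · exact funext fun v => hTd _ v.2
  · exact funext fun v => hYν _ v.2

theorem IsLevel.measurable_restrict (h : IsLevel P d ν n T Y) :
    Measurable fun ω => levelRestrict n (fun v => T v ω, fun v => Y v ω) :=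
  measurable_levelRestrict.comp h.measurable

theorem IsLevel.map_sizes [IsProbabilityMeasure ν] (h : IsLevel P d ν n T Y) :
    P.map (fun ω (v : {v : Node // v.length < n}) => T v ω) = Measure.infinitePi fun _ => d := by
  have h1 := congrArg (fun μ => μ.map Prod.fst) h.map_eq
  rw [Measure.map_map measurable_fst h.measurable_restrict] at h1
  refine h1.trans ?_
  simp [levelLaw]

variable [IsProbabilityMeasure d] [IsProbabilityMeasure ν]

theorem IsLevel.map_labels (h : IsLevel P d ν n T Y) :
    P.map (fun ω (v : {v : Node // v.length = n}) => Y v ω) = Measure.infinitePi fun _ => ν := by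
  have h1 := congrArg (fun μ => μ.map Prod.snd) h.map_eq
  rw [Measure.map_map measurable_snd h.measurable_restrict] at h1
  refine h1.trans ?_
  simp [levelLaw]

theorem IsLevel.map_size (h : IsLevel P d ν n T Y) {v : Node} (hv : v.length < n) :
    P.map (T v) = d := by
  have h1 := congrArg (fun μ => μ.map (fun x => x ⟨v, hv⟩)) h.map_sizes
  rw [Measure.map_map (measurable_pi_apply _) (Measurable.of_eval fun v => h.measurable_size _),
    Measure.infinitePi_map_eval] at h1
  exact h1

theorem IsLevel.map_label (h : IsLevel P d ν n T Y) {v : Node} (hv : v.length = n) :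
    P.map (Y v) = ν := by
  have h1 := congrArg (fun μ => μ.map (fun x => x ⟨v, hv⟩)) h.map_labels
  rw [Measure.map_map (measurable_pi_apply _) (Measurable.of_eval fun v => h.measurable_label _),
    Measure.infinitePi_map_eval] at h1
  exact h1

variable [IsProbabilityMeasure P]

theorem IsLevel.indep_sizes (h : IsLevel P d ν n T Y) :
    iIndepFun (fun v : {v : Node // v.length < n} => T v) P := by
  rw [iIndepFun_iff_map_fun_eq_infinitePi_map fun v => h.measurable_size _, h.map_sizes]
  congr 1
  exact funext fun v => (h.map_size v.2).symm

theorem IsLevel.indep_labels (h : IsLevel P d ν n T Y) :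
    iIndepFun (fun v : {v : Node // v.length = n} => Y v) P := by
  rw [iIndepFun_iff_map_fun_eq_infinitePi_map fun v => h.measurable_label _, h.map_labels]
  congr 1
  exact funext fun v => (h.map_label v.2).symm

theorem IsLevel.indep_labels_sizes (h : IsLevel P d ν n T Y) :
    IndepFun (fun ω (v : {v : Node // v.length = n}) => Y v ω)
      (fun ω (v : {v : Node // v.length < n}) => T v ω) P := by
  refine IndepFun.symm ?_
  rw [indepFun_iff_map_prod_eq_prod_map_map
    (Measurable.of_eval fun v => h.measurable_size _).aemeasurable
    (Measurable.of_eval fun v => h.measurable_label _).aemeasurable, h.map_sizes, h.map_labels]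
  exact h.map_eq

/-- One step of the recursion, from generation `n + 1` to generation `n`. -/
theorem IsLevel.step (h : IsLevel P d ν (n + 1) T Y) :
    IsLevel P d (stepLaw d ν) n T (fun v ω => vetoStep (T v ω) fun i => Y (v ++ [i]) ω) := by
  have hlen : ∀ v : {v : Node // v.length = n}, ∀ i, (v.1 ++ [i]).length = n + 1 := fun v i => by
    simp [v.2]
  have hlt : ∀ v : {v : Node // v.length = n}, v.1.length < n + 1 := fun v => by
    simp [v.2]
  -- Sizes and labels form one independent family, so each new claim reduces to disjointness of
  -- index sets: a vertex of generation `n` uses its own size and its daughters' labels.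
  have hall := iIndep_sumElim h.indep_sizes.iIndep h.indep_labels.iIndep (by
    refine indep_of_indep_of_le h.indep_labels_sizes.symm (iSup_le fun v => ?_)
      (iSup_le fun v => ?_)
    · exact ((measurable_pi_apply v).comp (comap_measurable
        fun ω (v : {v : Node // v.length < n + 1}) => T v ω)).comap_le
    · exact ((measurable_pi_apply v).comp (comap_measurable
        fun ω (v : {v : Node // v.length = n + 1}) => Y v ω)).comap_le)
  have hle : ∀ a, Sum.elim
      (fun v : {v : Node // v.length < n + 1} => MeasurableSpace.comap (T v) inferInstance)
      (fun v : {v : Node // v.length = n + 1} => MeasurableSpace.comap (Y v) inferInstance) a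
        ≤ mΩ := by
    rintro (v | v)
    · exact (h.measurable_size _).comap_le
    · exact (h.measurable_label _).comap_le
  have hTm : ∀ {S : Set ({v : Node // v.length < n + 1} ⊕ {v : Node // v.length = n + 1})} v,
      Sum.inl v ∈ S → Measurable[⨆ a ∈ S, Sum.elim
        (fun v : {v : Node // v.length < n + 1} => MeasurableSpace.comap (T v) inferInstance)
        (fun v : {v : Node // v.length = n + 1} => MeasurableSpace.comap (Y v) inferInstance) a]
        (T v) := fun v hv =>
    (comap_measurable (T v)).mono (le_iSup₂_of_le (f := fun a (_ : a ∈ _) => Sum.elim _ _ a)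
      (Sum.inl v) hv le_rfl) le_rfl
  have hYm : ∀ {S : Set ({v : Node // v.length < n + 1} ⊕ {v : Node // v.length = n + 1})} v,
      Sum.inr v ∈ S → Measurable[⨆ a ∈ S, Sum.elim
        (fun v : {v : Node // v.length < n + 1} => MeasurableSpace.comap (T v) inferInstance)
        (fun v : {v : Node // v.length = n + 1} => MeasurableSpace.comap (Y v) inferInstance) a]
        (Y v) := fun v hv =>
    (comap_measurable (Y v)).mono (le_iSup₂_of_le (f := fun a (_ : a ∈ _) => Sum.elim _ _ a)
      (Sum.inr v) hv le_rfl) le_rfl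
  refine IsLevel.of_indep h.measurable_size
    (fun v => (h.measurable_size v).vetoStep fun i => h.measurable_label _)
    (fun v hv => h.map_size (by omega)) (fun v hv => ?_)
    (h.indep_sizes.precomp (g := fun v : {v : Node // v.length < n} =>
      (⟨v.1, v.2.trans n.lt_succ_self⟩ : {v : Node // v.length < n + 1}))
      fun a b hab => by simpa [Subtype.ext_iff] using hab) ?_ ?_
  · refine map_vetoStep (h.measurable_size v) (h.map_size (hlt ⟨v, hv⟩))
      (fun i => h.measurable_label _) (fun i => h.map_label (hlen ⟨v, hv⟩ i)) ?_ ?_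
    · exact h.indep_labels.precomp (g := fun i => (⟨v ++ [i], hlen ⟨v, hv⟩ i⟩ :
        {v : Node // v.length = n + 1})) fun i j hij => by simpa using hij
    · exact h.indep_labels_sizes.symm.comp
        (φ := fun x : {v : Node // v.length < n + 1} → ℕ∞ => x ⟨v, hlt ⟨v, hv⟩⟩)
        (ψ := fun (x : {v : Node // v.length = n + 1} → I) i => x ⟨v ++ [i], hlen ⟨v, hv⟩ i⟩)
        (by fun_prop) (by fun_prop)
  · refine iIndepFun_of_biSup (S := fun v : {v : Node // v.length = n} =>
      {a | a = Sum.inl ⟨v.1, hlt v⟩ ∨ ∃ i, a = Sum.inr ⟨v.1 ++ [i], hlen v i⟩})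
      hle hall (fun v w hvw => ?_) fun v => ?_
    · refine Set.disjoint_left.2 ?_
      rintro a (rfl | ⟨i, rfl⟩) (ha | ⟨j, ha⟩)
      · exact hvw (by simpa [Subtype.ext_iff] using ha)
      · simp at ha
      · simp at ha
      · simp only [Sum.inr.injEq, Subtype.mk.injEq] at ha
        exact hvw (Subtype.ext (List.append_inj_left' ha rfl))
    · exact (hTm ⟨v.1, hlt v⟩ (Or.inl rfl)).vetoStep fun i =>
        hYm ⟨v.1 ++ [i], hlen v i⟩ (Or.inr ⟨i, rfl⟩)
  · refine indepFun_of_biSup (S := {a | (∃ v, a = Sum.inr v) ∨ ∃ v, a = Sum.inl v ∧ v.1.length = n})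
      (T := {a | ∃ v, a = Sum.inl v ∧ v.1.length < n}) hle hall ?_ ?_ ?_
    · refine Set.disjoint_left.2 ?_
      rintro a (⟨v, rfl⟩ | ⟨v, rfl, hv⟩) ⟨w, hw, hwn⟩
      · simp at hw
      · rw [Sum.inl.injEq] at hw
        rw [hw] at hv
        omega
    · refine Measurable.of_eval fun v => ?_
      exact (hTm ⟨v.1, hlt v⟩ (Or.inr ⟨_, rfl, v.2⟩)).vetoStep fun i =>
        hYm ⟨v.1 ++ [i], hlen v i⟩ (Or.inl ⟨_, rfl⟩)
    · refine Measurable.of_eval fun v => ?_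
      exact hTm ⟨v.1, by omega⟩ ⟨_, rfl, v.2⟩

end Level

theorem IsLevel.comp {Ω Ω' : Type*} [MeasurableSpace Ω] [MeasurableSpace Ω'] {P : Measure Ω}
    {P' : Measure Ω'} {d : Measure ℕ∞} {ν : Measure I} {n : ℕ} {T : Node → Ω' → ℕ∞}
    {Y : Node → Ω' → I} (h : IsLevel P' d ν n T Y) {f : Ω → Ω'} (hf : Measurable f)
    (hP : P.map f = P') : IsLevel P d ν n (fun v ω => T v (f ω)) (fun v ω => Y v (f ω)) := by
  refine ⟨fun v => (h.measurable_size v).comp hf, fun v => (h.measurable_label v).comp hf, ?_⟩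
  rw [← h.map_eq, ← hP, Measure.map_map h.measurable_restrict hf]
  rfl

/-- The law `levelLaw`, carried by trees with all generations. -/
noncomputable def extendedLevelLaw (d : Measure ℕ∞) (ν : Measure I) (n : ℕ) :
    Measure ((Node → ℕ∞) × (Node → I)) := (levelLaw d ν n).map (levelExtend n)

theorem isLevel_extendedLevelLaw (d : Measure ℕ∞) (ν : Measure I) (n : ℕ) :
    IsLevel (extendedLevelLaw d ν n) d ν n (fun v p => p.1 v) (fun v p => p.2 v) := by
  refine ⟨fun v => by fun_prop, fun v => by fun_prop, ?_⟩
  rw [extendedLevelLaw, Measure.map_map measurable_levelRestrict measurable_levelExtend]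
  refine Eq.trans ?_ Measure.map_id
  congr 1
  exact funext levelRestrict_levelExtend

theorem IsLevel.map_levelExtend {Ω : Type*} [MeasurableSpace Ω] {P : Measure Ω}
    {d : Measure ℕ∞} {ν : Measure I} {n : ℕ} {T : Node → Ω → ℕ∞}
    {Y : Node → Ω → I} (h : IsLevel P d ν n T Y) :
    P.map (fun ω => levelExtend n (levelRestrict n (fun v => T v ω, fun v => Y v ω))) =
      extendedLevelLaw d ν n := by
  rw [extendedLevelLaw, ← h.map_eq,
    Measure.map_map measurable_levelExtend h.measurable_restrict]
  rfl

/-- If the laws `ν n` are compatible with the recursion, there is a tree with independent family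
sizes and labels of law `ν n` in generation `n` that satisfy the recursion. -/
theorem exists_labelled_tree (d : Measure ℕ∞) [IsProbabilityMeasure d] (ν : ℕ → Measure I)
    [∀ n, IsProbabilityMeasure (ν n)] (hν : ∀ n, stepLaw d (ν (n + 1)) = ν n) :
    ∃ (Ω : Type) (_ : MeasurableSpace Ω) (P : Measure Ω) (N : Node → Ω → ℕ∞) (Z : Node → Ω → I),
      IsProbabilityMeasure P ∧ (∀ n, IsLevel P d (ν n) n N Z) ∧
      ∀ᵐ ω ∂P, ∀ v, Z v ω = vetoStep (N v ω) fun i => Z (v ++ [i]) ω := by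
  let Q : ℕ → Measure ((Node → ℕ∞) × (Node → I)) := fun n => extendedLevelLaw d (ν n) n
  -- One step of the recursion followed by truncation to generation `n`, so that the truncated laws
  -- form an inverse system.
  let g : ℕ → (Node → ℕ∞) × (Node → I) → (Node → ℕ∞) × (Node → I) := fun n p =>
    levelExtend n (levelRestrict n (p.1, fun v => vetoStep (p.1 v) fun i => p.2 (v ++ [i])))
  have hQ : ∀ n, IsProbabilityMeasure (Q n) := fun n =>
    Measure.isProbabilityMeasure_map measurable_levelExtend.aemeasurable
  have hg : ∀ n, Measurable (g n) := fun n => by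
    refine (measurable_levelExtend.comp measurable_levelRestrict).comp
      (measurable_fst.prodMk (Measurable.of_eval fun v => ?_))
    exact Measurable.vetoStep (by fun_prop) fun i => by fun_prop
  have hgQ : ∀ n, (Q (n + 1)).map (g n) = Q n := fun n => by
    have h := (isLevel_extendedLevelLaw d (ν (n + 1)) (n + 1)).step
    rw [hν] at h
    exact h.map_levelExtend
  obtain ⟨P, hP, hPQ, hPg⟩ := exists_inverseLimit Q hg hgQ
  -- Coordinate `n` stores sizes strictly before generation `n`, so the size of `v` first appears in
  -- coordinate `v.length + 1`; its label sits in coordinate `v.length`.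
  let N : Node → (ℕ → (Node → ℕ∞) × (Node → I)) → ℕ∞ := fun v ω => (ω (v.length + 1)).1 v
  let Z : Node → (ℕ → (Node → ℕ∞) × (Node → I)) → I := fun v ω => (ω v.length).2 v
  have hN : ∀ᵐ ω ∂P, ∀ n, ∀ v : Node, v.length < n → (ω n).1 v = N v ω := by
    filter_upwards [hPg] with ω hω n v hv
    induction n, hv using Nat.le_induction with
    | base => rfl
    | succ n hn ih =>
      rw [← ih, ← hω n]
      exact (show (g n (ω (n + 1))).1 v = (ω (n + 1)).1 v from dif_pos hn).symm
  have hZ : ∀ n, ∀ v : Node, v.length = n → ∀ ω, (ω n).2 v = Z v ω := by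
    rintro n v rfl ω
    rfl
  refine ⟨_, inferInstance, P, N, Z, hP, fun n => ?_, ?_⟩
  · have h1 := (isLevel_extendedLevelLaw d (ν n) n).comp (measurable_pi_apply n) (hPQ n)
    refine ⟨fun v => by fun_prop, fun v => by fun_prop, ?_⟩
    rw [← h1.map_eq]
    refine Measure.map_congr ?_
    filter_upwards [hN] with ω hω
    refine Prod.ext (funext fun v => (hω n v v.2).symm) (funext fun v => (hZ n v v.2 ω).symm)
  · filter_upwards [hN, hPg] with ω hω hωg v
    rw [← hZ _ v rfl, ← hωg]
    refine (dif_pos rfl).trans ?_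
    change vetoStep ((ω (v.length + 1)).1 v) (fun i => (ω (v.length + 1)).2 (v ++ [i])) = _
    congr 1
    funext i
    exact hZ _ _ (by simp) ω

/-- Every solution of the iterated equation is the law of a tree-indexed solution. -/
theorem IsSolutionLaw.exists_isTreeSolution {d : Measure ℕ∞} [IsProbabilityMeasure d]
    {ν : Measure I} (hν : IsSolutionLaw d ν) :
    ∃ (Ω : Type) (_ : MeasurableSpace Ω) (P : Measure Ω) (N : Node → Ω → ℕ∞)
      (X : EvenNode → Ω → I), IsProbabilityMeasure P ∧ IsFamilySizes P d N ∧
        IsTreeSolution P N X ∧ ∀ u, P.map (X u) = ν := by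
  have := hν.1
  -- Odd generations carry the image of `ν` under one step; two steps return to `ν` because it is a
  -- solution.
  let ν' : ℕ → Measure I := fun n => if Even n then ν else stepLaw d ν
  have h1 : ∀ n, IsProbabilityMeasure (ν' n) := fun n => by
    dsimp only [ν']; split_ifs <;> infer_instance
  have h2 : ∀ n, stepLaw d (ν' (n + 1)) = ν' n := fun n => by
    by_cases h : Even n
    · simp only [ν', h, if_true, Nat.even_add_one, not_true_eq_false, if_false]
      rw [← iterLaw_eq, hν.2]
    · simp only [ν', h, if_false, Nat.even_add_one, not_false_eq_true, if_true]
  obtain ⟨Ω, mΩ, P, N, Z, hP, hlev, heq⟩ := exists_labelled_tree d ν' h2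
  have hlaw : ∀ u : EvenNode, P.map (Z u.1) = ν := fun u => by
    rw [(hlev _).map_label rfl]
    exact if_pos u.2
  refine ⟨Ω, mΩ, P, N, fun u => Z u.1, hP, ⟨(hlev 0).measurable_size, fun u =>
    (hlev _).map_size u.length.lt_succ_self, ?_⟩, ⟨fun u => (hlev 0).measurable_label _,
    fun n => ?_, fun n => ?_, fun u => ?_, fun u v => (hlaw u).trans (hlaw v).symm⟩, hlaw⟩
  · rw [iIndepFun_iff_finset]
    intro s
    exact (hlev (s.sup List.length + 1)).indep_sizes.precomp
      (g := fun v : s => (⟨v.1, Nat.lt_succ_of_le (Finset.le_sup (f := List.length) v.2)⟩ :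
        {v : Node // v.length < s.sup List.length + 1}))
      fun a b hab => Subtype.ext (by have h := congrArg Subtype.val hab; exact h)
  · exact (hlev (2 * n)).indep_labels.precomp
      (g := fun u : {u : EvenNode // u.1.length = 2 * n} =>
        (⟨u.1.1, u.2⟩ : {v : Node // v.length = 2 * n}))
      fun a b hab => Subtype.ext (Subtype.ext
        (by have h := congrArg Subtype.val hab; exact h))
  · exact (hlev (2 * n)).indep_labels_sizes.comp
      (φ := fun (x : {v : Node // v.length = 2 * n} → I)
        (u : {u : EvenNode // u.1.length = 2 * n}) => x ⟨u.1.1, u.2⟩)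
      (by fun_prop) measurable_id
  · filter_upwards [heq] with ω hω
    rw [hω u.1, iterStep_eq]
    congr 1
    funext i
    rw [hω]
    congr 1
    funext j
    simp [EvenNode.grandchild]

/-! ### Analytic properties of the generating function. -/

section Pgf

variable {d : Measure ℕ∞} [IsProbabilityMeasure d]

theorem summable_measure_nat : Summable fun n : ℕ => d.real {(n : ℕ∞)} :=
  summable_measure_toReal (fun _ => .of_discrete) fun i j h => by
    simpa [Function.onFun] using h

theorem tsum_measure_nat : ∑' n : ℕ, d.real {(n : ℕ∞)} = 1 - d.real {⊤} := by
  have h1 : ∫ a, ({⊤}ᶜ : Set ℕ∞).indicator (fun _ => (1 : ℝ)) a ∂d = 1 - d.real {⊤} := by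
    rw [← Pi.one_def, integral_indicator_one .of_discrete, probReal_compl_eq_one_sub .of_discrete]
  rw [← h1, integral_countable ((integrable_const (1 : ℝ)).indicator .of_discrete),
    ← Function.Injective.tsum_eq (g := fun n : ℕ => (n : ℕ∞)) Nat.cast_injective]
  · exact tsum_congr fun n => by simp
  · intro n hn
    rcases eq_or_ne n ⊤ with rfl | h
    · simp at hn
    · lift n to ℕ using h
      exact ⟨n, rfl⟩

theorem measure_top_eq_zero (h : pgf d 1 = 1) : d {⊤} = 0 := by
  simp only [pgf, one_pow, mul_one, tsum_measure_nat] at h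
  have h1 : d.real {⊤} = 0 := by linarith
  simpa [Measure.real, ENNReal.toReal_eq_zero_iff] using h1

theorem summable_pgf {t : ℝ} (ht : t ∈ Set.Icc (0 : ℝ) 1) :
    Summable fun n : ℕ => d.real {(n : ℕ∞)} * t ^ n :=
  summable_measure_nat.of_nonneg_of_le (fun n => mul_nonneg measureReal_nonneg (pow_nonneg ht.1 n))
    fun _ => mul_le_of_le_one_right measureReal_nonneg (pow_le_one₀ ht.1 ht.2)

omit [IsProbabilityMeasure d] in
theorem pgf_nonneg {t : ℝ} (ht : 0 ≤ t) : 0 ≤ pgf d t :=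
  tsum_nonneg fun n => mul_nonneg measureReal_nonneg (pow_nonneg ht n)

theorem pgf_mono : MonotoneOn (pgf d) (Set.Icc 0 1) := fun _ hs _ ht hst =>
  (summable_pgf hs).tsum_le_tsum (fun _ => mul_le_mul_of_nonneg_left
    (pow_le_pow_left₀ hs.1 hst _) measureReal_nonneg) (summable_pgf ht)

/-- On `(0, r)` with `t < r < 1` the differentiated series is dominated by `∑ n rⁿ⁻¹`, which permits
termwise differentiation. -/
theorem differentiableAt_pgf {t : ℝ} (h0 : 0 < t) (h1 : t < 1) : DifferentiableAt ℝ (pgf d) t := by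
  obtain ⟨r, hr, hr1⟩ := exists_between h1
  have hr0 : 0 < r := h0.trans hr
  have hu : Summable fun n : ℕ => (n : ℝ) * r ^ (n - 1) := by
    have := (summable_pow_mul_geometric_of_norm_lt_one (R := ℝ) 1 (r := r)
      (by rwa [Real.norm_of_nonneg hr0.le])).mul_right r⁻¹
    refine this.congr fun n => ?_
    rcases n with _ | n
    · simp
    · simp only [Nat.add_sub_cancel, pow_succ]
      field_simp
  have hH := hasDerivAt_tsum_of_isPreconnected (g := fun (n : ℕ) t => d.real {(n : ℕ∞)} * t ^ n)
    (g' := fun (n : ℕ) t => d.real {(n : ℕ∞)} * (n * t ^ (n - 1))) (t := Set.Ioo 0 r) (y₀ := t)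
    (y := t) hu isOpen_Ioo isPreconnected_Ioo
    (fun n y _ => (hasDerivAt_pow n y).const_mul _) (fun n y hy => ?_) ⟨h0, hr⟩
    (summable_pgf ⟨h0.le, h1.le⟩) ⟨h0, hr⟩
  · exact hH.differentiableAt
  · rw [Real.norm_of_nonneg (by have := hy.1.le; positivity)]
    calc d.real {(n : ℕ∞)} * (n * y ^ (n - 1)) ≤ 1 * (n * y ^ (n - 1)) := by
          have := hy.1.le
          gcongr
          exact measureReal_le_one
      _ ≤ n * r ^ (n - 1) := by
          rw [one_mul]
          have := hy.1.le
          have := hy.2.le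
          gcongr

variable (hH0 : pgf d 0 = 0) (hH : StrictConvexOn ℝ (Set.Icc 0 1) (pgf d))
include hH0 hH

omit [IsProbabilityMeasure d] in
-- Strict convexity and `H(0) = 0` give `0 ≤ H(t/2) < H(t)/2`.
theorem pgf_pos {t : ℝ} (h0 : 0 < t) (h1 : t ≤ 1) : 0 < pgf d t := by
  have h := hH.2 (show (0 : ℝ) ∈ Set.Icc (0 : ℝ) 1 from ⟨le_rfl, zero_le_one⟩)
    (show t ∈ Set.Icc (0 : ℝ) 1 from ⟨h0.le, h1⟩) h0.ne
    (one_half_pos (α := ℝ)) one_half_pos (add_halves 1)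
  simp only [smul_eq_mul, hH0, mul_zero, zero_add] at h
  have := pgf_nonneg (d := d) (t := 1 / 2 * t) (by positivity)
  linarith

omit [IsProbabilityMeasure d] in
-- For `s < t`, the chord from the origin gives `H(s) ≤ (s/t) H(t) < H(t)`.
theorem pgf_strictMono : StrictMonoOn (pgf d) (Set.Icc 0 1) := by
  intro s hs t ht hst
  have ht0 : 0 < t := hs.1.trans_lt hst
  have hc := hH.convexOn.2 (show (0 : ℝ) ∈ Set.Icc (0 : ℝ) 1 from ⟨le_rfl, zero_le_one⟩) ht
    (show 0 ≤ 1 - s / t by rw [sub_nonneg, div_le_one ht0]; exact hst.le)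
    (div_nonneg hs.1 ht0.le) (sub_add_cancel 1 _)
  simp only [smul_eq_mul, hH0, mul_zero, zero_add, div_mul_cancel₀ _ ht0.ne'] at hc
  refine hc.trans_lt ?_
  have h1 : s / t < 1 := (div_lt_one ht0).2 hst
  have := pgf_pos hH0 hH ht0 ht.2
  nlinarith

end Pgf

/-! ### The second moment map of a two-cycle: convexity and fixed points. -/

/-- The effect of the iterated equation on the second moment of laws with mean `p`, where
`(p, m)` is a two-cycle. -/
noncomputable def momentMap (d : Measure ℕ∞) (p m x : ℝ) : ℝ :=
  2 * p - 1 + pgf d (2 * m - 1 + pgf d x)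

theorem momentMap_self {d : Measure ℕ∞} {p m : ℝ} (hpm : m = 1 - pgf d p) (hmp : p = 1 - pgf d m) : momentMap d p m p = p := by
  rw [momentMap, show 2 * m - 1 + pgf d p = m by linarith]
  linarith

section TwoCycle

variable {d : Measure ℕ∞} [IsProbabilityMeasure d] (hH0 : pgf d 0 = 0)
  (hH : StrictConvexOn ℝ (Set.Icc 0 1) (pgf d)) {p m : ℝ} (hp : p ∈ Set.Icc (0 : ℝ) 1)
  (hm : m ∈ Set.Icc (0 : ℝ) 1) (hpm : m = 1 - pgf d p) (hmp : p = 1 - pgf d m)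

include hp hm hpm in
theorem momentMap_arg_mem {x : ℝ} (hx : x ∈ Set.Icc 0 p) (h : 0 ≤ 2 * m - 1 + pgf d x) :
    2 * m - 1 + pgf d x ∈ Set.Icc (0 : ℝ) 1 := by
  refine ⟨h, ?_⟩
  have := pgf_mono (d := d) ⟨hx.1, hx.2.trans hp.2⟩ hp hx.2
  have := hm.2
  linarith

include hp hm hpm in
theorem momentMap_mono {x y : ℝ} (hx : 0 ≤ x) (hxy : x ≤ y) (hy : y ≤ p)
    (h : 0 ≤ 2 * m - 1 + pgf d x) : momentMap d p m x ≤ momentMap d p m y := by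
  have h1 := pgf_mono (d := d) ⟨hx, hxy.trans (hy.trans hp.2)⟩ ⟨hx.trans hxy, hy.trans hp.2⟩ hxy
  have h2 := pgf_mono (d := d) (momentMap_arg_mem hp hm hpm ⟨hx, hxy.trans hy⟩ h)
    (momentMap_arg_mem hp hm hpm ⟨hx.trans hxy, hy⟩ (by linarith)) (by linarith)
  unfold momentMap
  linarith

include hH0 hH hp hm hpm in
-- An increasing strictly convex function composed with a strictly convex one. The condition at `a`
-- keeps the inner argument in `[0,1]`; it holds at second moments of laws with mean `p`, where the
-- inner argument is itself a second moment.
theorem momentMap_strictConvexOn {a : ℝ} (ha : 0 ≤ a) (h : 0 ≤ 2 * m - 1 + pgf d a) :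
    StrictConvexOn ℝ (Set.Icc a p) (momentMap d p m) := by
  refine ⟨convex_Icc _ _, fun x hx y hy hxy s t hs ht hst => ?_⟩
  have hsub : ∀ {z}, z ∈ Set.Icc a p → z ∈ Set.Icc (0 : ℝ) 1 := fun hz =>
    ⟨ha.trans hz.1, hz.2.trans hp.2⟩
  have hmem : ∀ {z}, z ∈ Set.Icc a p → 2 * m - 1 + pgf d z ∈ Set.Icc (0 : ℝ) 1 := fun hz =>
    momentMap_arg_mem hp hm hpm ⟨ha.trans hz.1, hz.2⟩ (by
      have := pgf_mono (d := d) ⟨ha, hz.1.trans (hz.2.trans hp.2)⟩ (hsub hz) hz.1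
      linarith)
  have hz : s • x + t • y ∈ Set.Icc a p := convex_Icc a p hx hy hs.le ht.le hst
  have h1 := hH.2 (hsub hx) (hsub hy) hxy hs ht hst
  have hne : 2 * m - 1 + pgf d x ≠ 2 * m - 1 + pgf d y := fun e =>
    hxy ((pgf_strictMono hH0 hH).injOn (hsub hx) (hsub hy) (by linarith))
  have h2 := hH.2 (hmem hx) (hmem hy) hne hs ht hst
  have e : ∀ c A B : ℝ, s * (c + A) + t * (c + B) = c + (s * A + t * B) := fun c A B => by
    linear_combination c * hst
  have h3 := pgf_mono (d := d) (hmem hz)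
    (convex_Icc (0 : ℝ) 1 (hmem hx) (hmem hy) hs.le ht.le hst) (by
      simp only [smul_eq_mul] at h1 ⊢
      rw [e]
      linarith)
  simp only [momentMap, smul_eq_mul] at h2 h3 ⊢
  rw [e]
  linarith

include hH0 hH hp hm hpm hmp in
-- Three distinct fixed points would give two adjacent chords of slope 1, against strict convexity.
theorem eq_of_momentMap_eq {x y : ℝ} (hx0 : 0 ≤ x) (h : 0 ≤ 2 * m - 1 + pgf d x) (hxy : x ≤ y)
    (hy : y ≤ p) (hx : momentMap d p m x = x) (hy' : momentMap d p m y = y) : y = x ∨ y = p := by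
  by_contra! hne
  have hxy' : x < y := lt_of_le_of_ne hxy hne.1.symm
  have hyp : y < p := lt_of_le_of_ne hy hne.2
  have hc := (momentMap_strictConvexOn hH0 hH hp hm hpm hx0 h).slope_strict_mono_adjacent
    ⟨le_rfl, hxy.trans hy⟩ ⟨hxy.trans hy, le_rfl⟩ hxy' hyp
  rw [momentMap_self hpm hmp, hx, hy', div_self (sub_pos.2 hxy').ne',
    div_self (sub_pos.2 hyp).ne'] at hc
  exact lt_irrefl _ hc

omit [IsProbabilityMeasure d] in
include hH0 hH hm hpm hmp in
theorem twoCycle_mem_Ioo (h0 : 0 < p) (h1 : p < 1) : 0 < m ∧ m < 1 := by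
  have h2 := pgf_pos hH0 hH h0 h1.le
  refine ⟨hm.1.lt_of_ne fun h => ?_, by linarith⟩
  rw [← h, hH0] at hmp
  linarith

include hH0 hH hp hm hpm hmp in
-- If one point of the cycle is 1, then `H` vanishes at the other, which must be 0; hence `H(1) = 1`
-- and there is no mass at `⊤`.
theorem twoCycle_ne_one_or : p ≠ 1 ∧ m ≠ 1 ∨ d {⊤} = 0 := by
  have key : ∀ {p m : ℝ}, m ∈ Set.Icc (0 : ℝ) 1 → m = 1 - pgf d p → p = 1 - pgf d m → p = 1 →
      d {⊤} = 0 := by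
    rintro p m hm hpm hmp rfl
    refine measure_top_eq_zero ?_
    have h : m = 0 := by
      by_contra h
      have := pgf_pos hH0 hH (hm.1.lt_of_ne (Ne.symm h)) hm.2
      linarith
    linarith
  by_cases h1 : p = 1
  · exact Or.inr (key hm hpm hmp h1)
  by_cases h2 : m = 1
  · exact Or.inr (key hp hmp hpm h2)
  exact Or.inl ⟨h1, h2⟩

include hH0 hH hm hpm hmp in
theorem hasDerivAt_momentMap (h0 : 0 < p) (h1 : p < 1) :
    HasDerivAt (momentMap d p m) (deriv (pgf d) m * deriv (pgf d) p) p := by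
  obtain ⟨hm0, hm1⟩ := twoCycle_mem_Ioo hH0 hH hm hpm hmp h0 h1
  have e : 2 * m - 1 + pgf d p = m := by linarith
  have h2 : HasDerivAt (pgf d) (deriv (pgf d) m) (2 * m - 1 + pgf d p) := by
    rw [e]
    exact (differentiableAt_pgf hm0 hm1).hasDerivAt
  exact (h2.comp p ((differentiableAt_pgf h0 h1).hasDerivAt.const_add _)).const_add _

include hH0 hH hp hm hpm hmp in
-- The chord between the two fixed points has slope 1 and lies strictly below the tangent slope at
-- its right end.
theorem one_lt_of_momentMap_eq (h0 : 0 < p) (h1 : p < 1) {x : ℝ} (hx0 : 0 ≤ x)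
    (h : 0 ≤ 2 * m - 1 + pgf d x) (hxp : x < p) (hx : momentMap d p m x = x) :
    1 < deriv (pgf d) m * deriv (pgf d) p := by
  have hs := (momentMap_strictConvexOn hH0 hH hp hm hpm hx0 h).slope_lt_of_hasDerivAt
    ⟨le_rfl, hxp.le⟩ ⟨hxp.le, le_rfl⟩ hxp (hasDerivAt_momentMap hH0 hH hm hpm hmp h0 h1)
  rwa [slope_def_field, momentMap_self hpm hmp, hx, div_self (sub_pos.2 hxp).ne'] at hs

include hH0 hH hm hpm hmp in
-- A derivative above 1 at the fixed point pushes the graph under the diagonal just to the left of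
-- it.
theorem exists_momentMap_lt (h0 : 0 < p) (h1 : p < 1)
    (h : 1 < deriv (pgf d) m * deriv (pgf d) p) {a : ℝ} (ha : a < p) :
    ∃ x, a < x ∧ x < p ∧ momentMap d p m x < x := by
  have hs := (hasDerivAt_iff_tendsto_slope_left_right.1
    (hasDerivAt_momentMap hH0 hH hm hpm hmp h0 h1)).1
  obtain ⟨x, hx1, hx2⟩ := ((hs.eventually_const_lt h).and (Ioo_mem_nhdsLT ha)).exists
  refine ⟨x, hx2.1, hx2.2, ?_⟩
  rw [slope_def_field, momentMap_self hpm hmp, lt_div_iff_of_neg (sub_neg.2 hx2.2)] at hx1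
  linarith

include hH0 hH hm hpm hmp in
-- The chain rule gives `f⁽²⁾` the multiplier `H'(m)H'(p)` at `p`; it is nonnegative since `H` is
-- increasing, so the absolute value plays no role.
theorem isUnstableFixedPoint_iff (h0 : 0 < p) (h1 : p < 1) :
    IsUnstableFixedPoint (iterMeanMap d) p ↔ 1 < deriv (pgf d) m * deriv (pgf d) p := by
  obtain ⟨hm0, hm1⟩ := twoCycle_mem_Ioo hH0 hH hm hpm hmp h0 h1
  have h2 : HasDerivAt (pgf d) (deriv (pgf d) m) (1 - pgf d p) := by
    rw [← hpm]
    exact (differentiableAt_pgf hm0 hm1).hasDerivAt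
  have h3 : HasDerivAt (iterMeanMap d) (deriv (pgf d) m * deriv (pgf d) p) p := by
    have := (h2.comp p ((differentiableAt_pgf h0 h1).hasDerivAt.const_sub 1)).const_sub 1
    rwa [mul_neg, neg_neg] at this
  have hnn : ∀ {t}, 0 < t → t < 1 → 0 ≤ deriv (pgf d) t := by
    intro t ht0 ht1
    rw [← derivWithin_of_mem_nhds (Icc_mem_nhds ht0 ht1)]
    exact pgf_mono.derivWithin_nonneg
  rw [IsUnstableFixedPoint, h3.deriv, abs_of_nonneg (mul_nonneg (hnn hm0 hm1) (hnn h0 h1))]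
  refine and_iff_right ?_
  rw [iterMeanMap, ← hpm, ← hmp]

end TwoCycle

/-! ### Solutions of given mean and the two-point law. -/

section Solutions

variable {d : Measure ℕ∞} [IsProbabilityMeasure d] {p m : ℝ}

theorem mean_secondMoment_stepLaw_stepLaw (hpm : m = 1 - pgf d p) (hmp : p = 1 - pgf d m)
    (hne : p ≠ 1 ∧ m ≠ 1 ∨ d {⊤} = 0) {ν : Measure I} [IsProbabilityMeasure ν] (hν : mean ν = p) :
    mean (stepLaw d ν) = m ∧
    mean (stepLaw d (stepLaw d ν)) = p ∧
    0 ≤ 2 * m - 1 + pgf d (secondMoment ν) ∧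
    secondMoment (stepLaw d (stepLaw d ν)) = momentMap d p m (secondMoment ν) := by
  have h1 : mean (stepLaw d ν) = m := by
    rw [mean_stepLaw (hν ▸ hne.imp_left And.left), hν, ← hpm]
  have h2 : secondMoment (stepLaw d ν) = 2 * m - 1 + pgf d (secondMoment ν) := by
    rw [secondMoment_stepLaw (hν ▸ hne.imp_left And.left), hν]
    linarith
  refine ⟨h1, ?_, h2 ▸ (secondMoment_mem _).1, ?_⟩
  · rw [mean_stepLaw (h1 ▸ hne.imp_left And.right), h1, ← hmp]
  · rw [secondMoment_stepLaw (h1 ▸ hne.imp_left And.right), h1, h2, momentMap]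
    linarith

theorem twoPointLaw_prob (hp : p ∈ Set.Icc (0 : ℝ) 1) : IsProbabilityMeasure (twoPointLaw p) := by
  refine ⟨?_⟩
  simp only [twoPointLaw, Measure.add_apply, Measure.smul_apply, measure_univ, smul_eq_mul, mul_one]
  rw [← ENNReal.ofReal_add hp.1 (by linarith [hp.2])]
  simp

theorem integral_twoPointLaw (hp : p ∈ Set.Icc (0 : ℝ) 1) (f : I → ℝ) :
    ∫ x, f x ∂(twoPointLaw p) = p * f 1 + (1 - p) * f 0 := by
  rw [twoPointLaw, integral_add_measure, integral_smul_measure, integral_smul_measure,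
    integral_dirac, integral_dirac, ENNReal.toReal_ofReal hp.1,
    ENNReal.toReal_ofReal (by linarith [hp.2])]
  · rfl
  · exact (integrable_dirac (by simp)).smul_measure ENNReal.ofReal_ne_top
  · exact (integrable_dirac (by simp)).smul_measure ENNReal.ofReal_ne_top

theorem mean_twoPointLaw (hp : p ∈ Set.Icc (0 : ℝ) 1) : mean (twoPointLaw p) = p := by
  rw [mean, integral_twoPointLaw hp]
  simp

theorem secondMoment_twoPointLaw (hp : p ∈ Set.Icc (0 : ℝ) 1) :
    secondMoment (twoPointLaw p) = p := by
  rw [secondMoment, integral_twoPointLaw hp]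
  simp

theorem ae_eq_zero_or_one {ν : Measure I} [IsProbabilityMeasure ν]
    (h : secondMoment ν = mean ν) : ∀ᵐ x ∂ν, x = 0 ∨ x = 1 := by
  have hi : Integrable (fun x : I => (x : ℝ)) ν := integrable_unitInterval measurable_id
  have hi2 : Integrable (fun x : I => (x : ℝ) - (x : ℝ) ^ 2) ν := hi.sub (integrable_sq ν)
  have h1 : ∫ x : I, ((x : ℝ) - (x : ℝ) ^ 2) ∂ν = 0 := by
    rw [integral_sub hi (integrable_sq ν)]
    exact sub_eq_zero.2 h.symm
  rw [integral_eq_zero_iff_of_nonneg (fun x => by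
      have := x.2.1
      have := x.2.2
      simp only [Pi.zero_apply]
      nlinarith) hi2] at h1
  filter_upwards [h1] with x hx
  have h2 : (x : ℝ) * (1 - x) = 0 := by
    simp only [Pi.zero_apply] at hx
    linarith
  rcases mul_eq_zero.1 h2 with h | h
  · exact Or.inl (Subtype.ext h)
  · exact Or.inr (Subtype.ext (by rw [Set.Icc.coe_one]; linarith))

/-- A law on `[0,1]` is determined by its mean if the second moment equals the mean. -/
theorem eq_twoPointLaw {ν : Measure I} [IsProbabilityMeasure ν] (hν : mean ν = p)
    (h : secondMoment ν = p) : ν = twoPointLaw p := by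
  have hp : p ∈ Set.Icc (0 : ℝ) 1 := hν ▸ mean_mem ν
  have h01 := ae_eq_zero_or_one (h.trans hν.symm)
  have := twoPointLaw_prob hp
  refine ext_of_forall_integral_eq_of_IsFiniteMeasure fun f => ?_
  rw [integral_twoPointLaw hp]
  have h1 : ∀ᵐ x ∂ν, f x = f 0 - (f 0 - f 1) * x + 0 := by
    filter_upwards [h01] with x hx
    rcases hx with rfl | rfl <;> simp
  rw [integral_congr_ae h1, integral_const_sub_mul_add (f := fun x : I => (x : ℝ))
    (g := fun _ => (0 : ℝ))
    (integrable_unitInterval measurable_id) (integrable_zero _ _ _)]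
  change f 0 - (f 0 - f 1) * mean ν + _ = _
  rw [hν]
  simp
  ring

/-- Two steps preserve mean `p` and second moment `p`, and these two moments determine the law. -/
theorem isSolutionLaw_twoPointLaw (hp : p ∈ Set.Icc (0 : ℝ) 1) (hpm : m = 1 - pgf d p)
    (hmp : p = 1 - pgf d m) (hne : p ≠ 1 ∧ m ≠ 1 ∨ d {⊤} = 0) :
    IsSolutionLaw d (twoPointLaw p) := by
  have := twoPointLaw_prob hp
  refine ⟨this, ?_⟩
  obtain ⟨-, h1, -, h2⟩ := mean_secondMoment_stepLaw_stepLaw hpm hmp hne (mean_twoPointLaw hp)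
  rw [secondMoment_twoPointLaw hp, momentMap_self hpm hmp] at h2
  rw [iterLaw_eq]
  exact eq_twoPointLaw h1 h2

end Solutions

/-! ### The limit of the cut-off recursion. -/

section Cutoff

variable {Ω : Type*} {mΩ : MeasurableSpace Ω} {P : Measure Ω} {d : Measure ℕ∞} {ν : Measure I}
  {N : Node → Ω → ℕ∞}

theorem IsLevel.congr {n : ℕ} {Y Y' : Node → Ω → I} (h : IsLevel P d ν n N Y)
    (hY' : ∀ v, Measurable (Y' v)) (hYY' : ∀ v, v.length = n → Y v = Y' v) :
    IsLevel P d ν n N Y' := by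
  refine ⟨h.measurable_size, hY', ?_⟩
  rw [← h.map_eq]
  congr 1
  funext ω
  exact Prod.ext rfl (funext fun v => (congrFun (hYY' v v.2) ω).symm)

instance isProbabilityMeasure_iterate_stepLaw [IsProbabilityMeasure d] [IsProbabilityMeasure ν] (k : ℕ) :
    IsProbabilityMeasure ((stepLaw d)^[k] ν) := by
  induction k with
  | zero => assumption
  | succ k ih => rw [Function.iterate_succ_apply']; infer_instance

theorem measurable_cutoff (hN : ∀ u, Measurable (N u)) (c : I) (n : ℕ) (u : Node) :
    Measurable fun ω => cutoff c (fun v => N v ω) n u :=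
  Measurable.unroll (X := fun _ _ => c) (fun _ => hN _) fun _ => measurable_const

theorem IsFamilySizes.isLevel_const (hN : IsFamilySizes P d N) (c : I) (n : ℕ) :
    IsLevel P d (Measure.dirac c) n N (fun _ _ => c) := by
  have := hN.indep.isProbabilityMeasure
  refine .of_indep hN.measurable (fun v => measurable_const) (fun v _ => hN.law v)
    (fun v _ => by rw [Measure.map_const]; simp) (hN.indep.precomp Subtype.val_injective) ?_ ?_
  · rw [iIndepFun_iff_map_fun_eq_infinitePi_map fun v => measurable_const, Measure.map_const]
    simp [Measure.infinitePi_dirac]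
  · exact indepFun_const_left _ _

theorem IsFamilySizes.isLevel_cutoff [IsProbabilityMeasure d] (hN : IsFamilySizes P d N) (c : I) {n k l : ℕ}
    (h : l + k = 2 * n) :
    IsLevel P d ((stepLaw d)^[k] (Measure.dirac c)) l N
      (fun v ω => cutoff c (fun v => N v ω) n v) := by
  have := hN.indep.isProbabilityMeasure
  induction k generalizing l with
  | zero =>
    refine (hN.isLevel_const c l).congr (measurable_cutoff hN.measurable c n) fun v hv => ?_
    funext ω
    exact (cutoff_of_le c _ (n := n) (u := v) (by omega)).symm
  | succ k ih =>
    rw [Function.iterate_succ_apply']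
    refine (ih (l := l + 1) (by omega)).step.congr (measurable_cutoff hN.measurable c n)
      fun v hv => ?_
    funext ω
    exact (cutoff_of_lt c (fun v => N v ω) (n := n) (u := v) (by omega)).symm

theorem IsFamilySizes.map_cutoff [IsProbabilityMeasure d] (hN : IsFamilySizes P d N) (c : I) {n k : ℕ} {u : Node}
    (h : u.length + k = 2 * n) :
    P.map (fun ω => cutoff c (fun v => N v ω) n u) = (stepLaw d)^[k] (Measure.dirac c) := by
  have := hN.indep.isProbabilityMeasure
  exact (hN.isLevel_cutoff c h).map_label rfl

/-- The limit of the cut-off recursion as the cut-off recedes. -/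
noncomputable def cutoffLimit (c : I) (t : Node → ℕ∞) (u : Node) : I :=
  limsup (fun n => cutoff c t n u) atTop

/-- Taking a limsup needs no convergence, so the limit is exactly, not just almost surely, a
function of the subtree at `u`. -/
theorem measurable_cutoffLimit_subtree (N : Node → Ω → ℕ∞) (c : I) (u : Node) :
    Measurable[⨆ v ∈ {v | u <+: v}, MeasurableSpace.comap (N v) inferInstance]
      (fun ω => cutoffLimit c (fun v => N v ω) u) := by
  refine Measurable.limsup fun n => ?_
  refine Measurable.unroll (X := fun _ _ => c) (fun w => ?_) fun _ => measurable_const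
  exact measurable_biSup_comap (S := {v | u <+: v}) (List.prefix_append u w)

theorem measurable_cutoffLimit (hN : ∀ u, Measurable (N u)) (c : I) (u : Node) :
    Measurable fun ω => cutoffLimit c (fun v => N v ω) u :=
  Measurable.limsup fun n => measurable_cutoff hN c n u

/-- Variables that depend on disjoint subtrees are independent. -/
theorem IsFamilySizes.indep_of_subtree (hN : IsFamilySizes P d N) {Y : Node → Ω → I}
    (hY : ∀ u, Measurable[⨆ v ∈ {v | u <+: v}, MeasurableSpace.comap (N v) inferInstance] (Y u))
    (n : ℕ) :
    iIndepFun (fun v : {v : Node // v.length = n} => Y v) P ∧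
      IndepFun (fun ω (v : {v : Node // v.length = n}) => Y v ω)
        (fun ω (v : {v : Node // v.length < n}) => N v ω) P := by
  have hle : ∀ v, MeasurableSpace.comap (N v) inferInstance ≤ mΩ := fun v =>
    (hN.measurable v).comap_le
  constructor
  · refine iIndepFun_of_biSup (S := fun u : {v : Node // v.length = n} => {v | u.1 <+: v}) hle
      hN.indep.iIndep (fun u u' huu' => Set.disjoint_left.2 fun v hv hv' => huu' ?_) fun u => hY u
    refine Subtype.ext (List.IsPrefix.eq_of_length ?_ (u.2.trans u'.2.symm))
    exact List.prefix_of_prefix_length_le hv hv' (u.2.trans u'.2.symm).le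
  · refine indepFun_of_biSup (S := {v | n ≤ v.length}) (T := {v | v.length < n}) hle
      hN.indep.iIndep (Set.disjoint_left.2 fun v (hv : n ≤ _) (hv' : _ < n) => by omega)
      (Measurable.of_eval fun u => ?_) (Measurable.of_eval fun v => ?_)
    · exact (hY u).mono (biSup_mono fun v hv => u.2.symm.le.trans (List.IsPrefix.length_le hv))
        le_rfl
    · exact measurable_biSup_comap (S := {v : Node | v.length < n}) v.2

theorem IsFamilySizes.map_tree (hN : IsFamilySizes P d N) :
    P.map (fun ω v => N v ω) = Measure.infinitePi fun _ => d := by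
  have := hN.indep.isProbabilityMeasure
  rw [(iIndepFun_iff_map_fun_eq_infinitePi_map hN.measurable).1 hN.indep]
  congr 1
  exact funext hN.law

theorem tendsto_cutoffLimit {c : I} {t : Node → ℕ∞} {u : Node}
    (h : ∃ x, Tendsto (fun n => cutoff c t n u) atTop (𝓝 x)) :
    Tendsto (fun n => cutoff c t n u) atTop (𝓝 (cutoffLimit c t u)) := by
  obtain ⟨x, hx⟩ := h
  rwa [cutoffLimit, hx.limsup_eq]

/-- The cut-off recursion converges on every tree if a tree-indexed solution with the right mean
exists on some tree. -/
theorem IsFamilySizes.tendsto_cutoff [IsProbabilityMeasure d] (hN : IsFamilySizes P d N) (hν : IsSolutionLaw d ν) {c : I}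
    (hc : mean ν = c) :
    ∀ᵐ ω ∂P, ∀ u, Tendsto (fun n => cutoff c (fun v => N v ω) n u) atTop
      (𝓝 (cutoffLimit c (fun v => N v ω) u)) := by
  obtain ⟨Ω', mΩ', P', N', X, hP', hN', hX, hXν⟩ := hν.exists_isTreeSolution
  refine ae_all_iff.2 fun u => ?_
  have hs : MeasurableSet {t : Node → ℕ∞ | ∃ x, Tendsto (fun n => cutoff c t n u) atTop (𝓝 x)} :=
    measurableSet_exists_tendsto fun n =>
      measurable_cutoff (N := fun v (t : Node → ℕ∞) => t v) (fun v => measurable_pi_apply v) c n u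
  have h1 : ∀ᵐ ω ∂P', ∃ x, Tendsto (fun n => cutoff c (fun v => N' v ω) n u) atTop (𝓝 x) := by
    filter_upwards [hX.tendsto_cutoff hN'.measurable (fun v => by rw [hXν, hc]) u] with ω hω
    have hmem := isClosed_Icc.mem_of_tendsto hω
      (Eventually.of_forall fun n => (cutoff c (fun v => N' v ω) n u).2)
    exact ⟨⟨_, hmem⟩, tendsto_subtype_rng.2 hω⟩
  -- Convergence is an event about the tree alone, and all trees of family sizes have this product
  -- law; so it transfers from the auxiliary space to the given one.
  have h2 : ∀ᵐ t ∂(Measure.infinitePi fun _ : Node => d),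
      ∃ x, Tendsto (fun n => cutoff c t n u) atTop (𝓝 x) := by
    rw [← hN'.map_tree]
    exact (ae_map_iff (Measurable.of_eval hN'.measurable).aemeasurable hs).2 h1
  rw [← hN.map_tree] at h2
  filter_upwards [(ae_map_iff (Measurable.of_eval hN.measurable).aemeasurable hs).1 h2] with ω hω
  exact tendsto_cutoffLimit hω

theorem tendsto_integral_boundedContinuous [IsProbabilityMeasure P] {X : ℕ → Ω → I} {Y : Ω → I}
    (hX : ∀ n, Measurable (X n)) (hY : Measurable Y)
    (h : ∀ᵐ ω ∂P, Tendsto (fun n => X n ω) atTop (𝓝 (Y ω))) (f : BoundedContinuousFunction I ℝ) :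
    Tendsto (fun n => ∫ x, f x ∂(P.map (X n))) atTop (𝓝 (∫ x, f x ∂(P.map Y))) := by
  have e : ∀ {Z : Ω → I}, Measurable Z → ∫ x, f x ∂(P.map Z) = ∫ ω, f (Z ω) ∂P := fun hZ =>
    integral_map hZ.aemeasurable f.continuous.aestronglyMeasurable
  rw [e hY]
  simp only [fun n => e (hX n)]
  refine tendsto_integral_of_dominated_convergence (fun _ => ‖f‖) (fun n => ?_)
    (integrable_const _) (fun n => ae_of_all _ fun ω => f.norm_coe_le_norm _) ?_
  · exact (f.continuous.measurable.comp (hX n)).aestronglyMeasurable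
  · filter_upwards [h] with ω hω using (f.continuous.tendsto _).comp hω

theorem map_eq_of_tendsto {Ω' : Type*} [MeasurableSpace Ω']
    [IsProbabilityMeasure P] {P' : Measure Ω'} [IsProbabilityMeasure P']
    {X : ℕ → Ω → I} {Y : Ω → I} {X' : ℕ → Ω' → I} {Y' : Ω' → I}
    (hX : ∀ n, Measurable (X n)) (hX' : ∀ n, Measurable (X' n)) (hY : Measurable Y)
    (hY' : Measurable Y') (h : ∀ᵐ ω ∂P, Tendsto (fun n => X n ω) atTop (𝓝 (Y ω)))
    (h' : ∀ᵐ ω ∂P', Tendsto (fun n => X' n ω) atTop (𝓝 (Y' ω)))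
    (heq : ∀ n, P.map (X n) = P'.map (X' n)) : P.map Y = P'.map Y' := by
  have := Measure.isProbabilityMeasure_map (μ := P) hY.aemeasurable
  have := Measure.isProbabilityMeasure_map (μ := P') hY'.aemeasurable
  refine ext_of_forall_integral_eq_of_IsFiniteMeasure fun f => ?_
  refine tendsto_nhds_unique (tendsto_integral_boundedContinuous hX hY h f) ?_
  simp only [heq]
  exact tendsto_integral_boundedContinuous hX' hY' h' f

/-- All limits of the cut-off recursion at even vertices have the same law. -/
theorem map_cutoffLimit_eq [IsProbabilityMeasure d] {Ω' : Type*} [MeasurableSpace Ω']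
    {P' : Measure Ω'} {N' : Node → Ω' → ℕ∞} (hN : IsFamilySizes P d N)
    (hN' : IsFamilySizes P' d N') (hν : IsSolutionLaw d ν) {c : I} (hc : mean ν = c)
    (u v : EvenNode) :
    P.map (fun ω => cutoffLimit c (fun v => N v ω) u.1) =
      P'.map (fun ω => cutoffLimit c (fun v => N' v ω) v.1) := by
  have := hN.indep.isProbabilityMeasure
  have := hN'.indep.isProbabilityMeasure
  obtain ⟨k, hk⟩ := u.2
  obtain ⟨l, hl⟩ := v.2
  -- With `u` in generation `2k`, shifting the cut-off index by `k` leaves `2n` generations below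
  -- `u`, and likewise for `v`; the approximants then have equal laws.
  refine map_eq_of_tendsto (X := fun n ω => cutoff c (fun v => N v ω) (n + k) u.1)
    (X' := fun n ω => cutoff c (fun v => N' v ω) (n + l) v.1)
    (fun n => measurable_cutoff hN.measurable _ _ _)
    (fun n => measurable_cutoff hN'.measurable _ _ _) (measurable_cutoffLimit hN.measurable _ _)
    (measurable_cutoffLimit hN'.measurable _ _) ?_ ?_ fun n => ?_
  · filter_upwards [hN.tendsto_cutoff hν hc] with ω hω
    exact (hω u.1).comp (tendsto_add_atTop_nat k)
  · filter_upwards [hN'.tendsto_cutoff hν hc] with ω hω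
    exact (hω v.1).comp (tendsto_add_atTop_nat l)
  · rw [hN.map_cutoff c (k := 2 * n) (by omega), hN'.map_cutoff c (k := 2 * n) (by omega)]

end Cutoff

/-- A variable in `[0,1]` agrees with its conditional expectation if the second moments agree. -/
theorem ae_eq_of_condExp_of_secondMoment_eq {Ω : Type*} {𝒢 mΩ : MeasurableSpace Ω}
    {P : Measure Ω} [IsProbabilityMeasure P] (h𝒢 : 𝒢 ≤ mΩ) {X Y : Ω → I} (hX : Measurable X) (hY : Measurable[𝒢] Y)
    (h : P[fun ω => (X ω : ℝ) | 𝒢] =ᵐ[P] fun ω => (Y ω : ℝ))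
    (h2 : secondMoment (P.map X) = secondMoment (P.map Y)) : X =ᵐ[P] Y := by
  have hY' : Measurable Y := hY.mono h𝒢 le_rfl
  have iX := integrable_unitInterval (P := P) hX
  have iXX := integrable_unitInterval (P := P) (hX.mul hX)
  have iYY := integrable_unitInterval (P := P) (hY'.mul hY')
  have iXY := integrable_unitInterval (P := P) (hX.mul hY')
  simp only [Pi.mul_apply, Set.Icc.coe_mul] at iXX iYY iXY
  -- Since `Y = E[X | 𝒢]`, orthogonality gives `E[XY] = E[Y²]`, whence `E[(X - Y)²] = E[X²] -
  -- E[Y²]`.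
  have hXY : ∫ ω, (X ω : ℝ) * Y ω ∂P = ∫ ω, (Y ω : ℝ) * Y ω ∂P := by
    rw [← integral_condExp h𝒢]
    refine integral_congr_ae ?_
    have hm := condExp_mul_of_stronglyMeasurable_right (μ := P) (m := 𝒢)
      (f := fun ω => (X ω : ℝ)) (g := fun ω => (Y ω : ℝ))
      (measurable_subtype_coe.comp hY).stronglyMeasurable iXY iX
    filter_upwards [hm, h] with ω h1 h2
    refine h1.trans ?_
    rw [Pi.mul_apply, h2]
  rw [secondMoment_map hX, secondMoment_map hY'] at h2
  simp only [sq] at h2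
  have i1 : Integrable (fun ω => (X ω : ℝ) * X ω - 2 * ((X ω : ℝ) * Y ω)) P :=
    iXX.sub (iXY.const_mul 2)
  have hsq : ∀ ω, ((X ω : ℝ) - Y ω) ^ 2 =
      (X ω : ℝ) * X ω - 2 * ((X ω : ℝ) * Y ω) + (Y ω : ℝ) * Y ω := fun ω => by ring
  have hint : ∫ ω, ((X ω : ℝ) - Y ω) ^ 2 ∂P = 0 := by
    simp only [hsq]
    rw [integral_add i1 iYY, integral_sub iXX (iXY.const_mul 2), integral_const_mul, hXY, h2]
    ring
  rw [integral_eq_zero_iff_of_nonneg (fun ω => sq_nonneg _) (by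
    simp only [hsq]
    exact i1.add iYY)] at hint
  filter_upwards [hint] with ω hω
  exact Subtype.ext (sub_eq_zero.1 (pow_eq_zero_iff two_ne_zero |>.1 hω))

section TreeSolution

variable {Ω : Type*} {mΩ : MeasurableSpace Ω} {P : Measure Ω} {d : Measure ℕ∞}
  {N : Node → Ω → ℕ∞} {X : EvenNode → Ω → I}

theorem IsTreeSolution.isSolutionLaw [IsProbabilityMeasure d] (hN : IsFamilySizes P d N)
    (hX : IsTreeSolution P N X) (u : EvenNode) : IsSolutionLaw d (P.map (X u)) := by
  have := hN.indep.isProbabilityMeasure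
  have hp := Measure.isProbabilityMeasure_map (μ := P) (hX.measurable u).aemeasurable
  refine ⟨hp, ?_⟩
  have hev : ∀ v : {v : Node // v.length = 2}, Even v.1.length := fun v => by
    rw [v.2]; exact even_two
  have hlev : ∀ v : {v : Node // v.length = 2}, extendOdd N X v = X ⟨v.1, hev v⟩ := fun v =>
    extendOdd_even N X ⟨v.1, hev v⟩
  have h2 : IsLevel P d (P.map (X u)) 2 N (extendOdd N X) := by
    refine .of_indep hN.measurable (measurable_extendOdd hN.measurable hX.measurable)
      (fun v _ => hN.law v) (fun v hv => ?_) (hN.indep.precomp Subtype.val_injective) ?_ ?_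
    · rw [hlev ⟨v, hv⟩]
      exact hX.stationary _ _
    · simp only [hlev]
      exact (hX.indep 1).precomp (g := fun v : {v : Node // v.length = 2} =>
        (⟨⟨v.1, hev v⟩, v.2⟩ : {u : EvenNode // u.1.length = 2 * 1}))
        fun a b hab => by simpa [Subtype.ext_iff] using hab
    · simp only [hlev]
      exact (hX.indep_tree 1).comp
        (φ := fun (x : {u : EvenNode // u.1.length = 2 * 1} → I)
          (v : {v : Node // v.length = 2}) => x ⟨⟨v.1, hev v⟩, v.2⟩)
        (by fun_prop) measurable_id
  rw [iterLaw_eq, ← h2.step.step.map_label (v := []) rfl,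
    hX.stationary u ⟨[], by simp⟩]
  refine Measure.map_congr ?_
  filter_upwards [hX.extendOdd_equation] with ω hω
  rw [← congrFun (extendOdd_even N X ⟨[], by simp⟩) ω, hω]
  congr 1
  funext i
  exact (hω _).symm

theorem IsTreeSolution.condExp_eq_cutoffLimit [IsProbabilityMeasure d] (hN : IsFamilySizes P d N)
    (hX : IsTreeSolution P N X) {c : I} (hc : ∀ u, mean (P.map (X u)) = c) (u : EvenNode) :
    P[fun ω => (X u ω : ℝ) | treeSigma N] =ᵐ[P]
      fun ω => (cutoffLimit c (fun v => N v ω) u.1 : ℝ) := by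
  have := hN.indep.isProbabilityMeasure
  filter_upwards [hX.tendsto_cutoff hN.measurable hc u.1,
    hN.tendsto_cutoff (hX.isSolutionLaw hN u) (hc u)] with ω h1 h2
  rw [extendOdd_even] at h1
  exact tendsto_nhds_unique h1 ((continuous_subtype_val.tendsto _).comp (h2 u.1))

theorem measurable_cutoffLimit_treeSigma (N : Node → Ω → ℕ∞) (c : I) (u : Node) :
    Measurable[treeSigma N] fun ω => cutoffLimit c (fun v => N v ω) u :=
  (measurable_cutoffLimit_subtree N c u).mono (iSup₂_le fun v _ => le_iSup_of_le v le_rfl) le_rfl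

end TreeSolution

/-! ### The endogenous solution and the minimality of its second moment. -/

section Endogenous

variable {Ω : Type*} {mΩ : MeasurableSpace Ω} {P : Measure Ω} {d : Measure ℕ∞}
  [IsProbabilityMeasure d] {N : Node → Ω → ℕ∞} {p m : ℝ}

theorem mean_iterate_stepLaw (hpm : m = 1 - pgf d p) (hmp : p = 1 - pgf d m)
    (hne : p ≠ 1 ∧ m ≠ 1 ∨ d {⊤} = 0) {ν : Measure I} [IsProbabilityMeasure ν] (hν : mean ν = p)
    (k : ℕ) : mean ((stepLaw d)^[k] ν) = if Even k then p else m := by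
  induction k with
  | zero => simpa using hν
  | succ k ih =>
    rw [Function.iterate_succ_apply', mean_stepLaw (by
      rw [ih]
      refine hne.imp_left fun h => ?_
      split_ifs
      exacts [h.1, h.2]), ih]
    by_cases hk : Even k
    · simp [hk, Nat.even_add_one, ← hpm]
    · simp [hk, Nat.even_add_one, ← hmp]

theorem mean_dirac (c : I) : mean (Measure.dirac c) = c := by simp [mean]

/-- In the limit, the cut-off recursion becomes a solution of the recursive equation. -/
theorem IsFamilySizes.cutoffLimit_equation (hN : IsFamilySizes P d N) {ν : Measure I}
    (hν : IsSolutionLaw d ν) {c : I} (hc : mean ν = c) (hpm : m = 1 - pgf d c)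
    (hmp : (c : ℝ) = 1 - pgf d m) (hm : m ≤ 1) (hne : (c : ℝ) ≠ 1 ∧ m ≠ 1 ∨ d {⊤} = 0) :
    ∀ᵐ ω ∂P, ∀ u, cutoffLimit c (fun v => N v ω) u =
      vetoStep (N u ω) fun i => cutoffLimit c (fun v => N v ω) (u ++ [i]) := by
  have := hN.indep.isProbabilityMeasure
  have hlim := hN.tendsto_cutoff hν hc
  refine ae_all_iff.2 fun u => ?_
  -- Where the family is infinite, passage to the limit in the product fails in general. If both
  -- cycle points are below 1, the approximating and limiting products all vanish almost surely;
  -- otherwise infinite families are null.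
  have hzero : ∀ᵐ ω ∂P, N u ω = ⊤ →
      (∀ n, u.length + 1 ≤ 2 * n →
        liveProd ⊤ (fun i => cutoff c (fun v => N v ω) n (u ++ [i])) = 0) ∧
      liveProd ⊤ (fun i => cutoffLimit c (fun v => N v ω) (u ++ [i])) = 0 := by
    rcases hne with hne | hd
    · have hlt : ∀ k : ℕ, (if Even k then (c : ℝ) else m) < 1 := fun k => by
        split_ifs
        exacts [lt_of_le_of_ne c.2.2 hne.1, lt_of_le_of_ne hm hne.2]
      have hmean : ∀ n i, u.length + 1 ≤ 2 * n →
          ∫ ω, (cutoff c (fun v => N v ω) n (u ++ [i]) : ℝ) ∂P =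
            if Even (2 * n - (u.length + 1)) then (c : ℝ) else m := fun n i hn => by
        rw [← mean_map (measurable_cutoff hN.measurable c n _),
          hN.map_cutoff c (k := 2 * n - (u.length + 1)) (by
            rw [List.length_append, List.length_singleton]; omega),
          mean_iterate_stepLaw hpm hmp (Or.inl hne) (mean_dirac c)]
      have hchild : Function.Injective fun i => (⟨u ++ [i], by simp⟩ :
          {v : Node // v.length = u.length + 1}) := fun i j h => by simpa using h
      have h1 : ∀ᵐ ω ∂P, ∀ n, u.length + 1 ≤ 2 * n →
          liveProd ⊤ (fun i => cutoff c (fun v => N v ω) n (u ++ [i])) = 0 := by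
        refine ae_all_iff.2 fun n => ?_
        by_cases hn : u.length + 1 ≤ 2 * n
        · have hind := ((hN.isLevel_cutoff c (l := u.length + 1)
            (Nat.add_sub_of_le hn)).indep_labels).precomp hchild
          filter_upwards [liveProd_top_eq_zero_ae
            (fun i => measurable_cutoff hN.measurable c n (u ++ [i])) hind (hlt _)
            fun i => hmean n i hn] with ω hω _ using hω
        · exact ae_of_all _ fun ω h => absurd h hn
      have h2 : ∀ᵐ ω ∂P, liveProd ⊤ (fun i => cutoffLimit c (fun v => N v ω) (u ++ [i])) = 0 := by
        refine liveProd_top_eq_zero_ae (c := if Even (u.length + 1) then (c : ℝ) else m)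
          (fun i => measurable_cutoffLimit hN.measurable c _)
          ((hN.indep_of_subtree (measurable_cutoffLimit_subtree N c) (u.length + 1)).1.precomp
            hchild) (hlt _) fun i => ?_
        refine tendsto_nhds_unique (tendsto_integral_unitInterval
          (fun n => measurable_cutoff hN.measurable c n _)
          (hlim.mono fun ω hω => hω (u ++ [i]))) ?_
        refine tendsto_const_nhds.congr' ?_
        filter_upwards [eventually_ge_atTop (u.length + 1)] with n hn
        rw [hmean n i (by omega)]
        congr 1
        rw [Nat.even_sub (by omega)]
        simp
      filter_upwards [h1, h2] with ω h1 h2 _ using ⟨h1, h2⟩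
    · have h : ∀ᵐ ω ∂P, N u ω ≠ ⊤ := by
        have h0 : P.map (N u) {⊤} = 0 := by rw [hN.law, hd]
        rw [Measure.map_apply (hN.measurable u) .of_discrete] at h0
        exact measure_eq_zero_iff_ae_notMem.1 h0
      filter_upwards [h] with ω hω h using absurd h hω
  filter_upwards [hlim, hzero] with ω hω h0
  refine tendsto_nhds_unique (hω u) ?_
  have hev : ∀ᶠ n in atTop, vetoStep (N u ω) (fun i => cutoff c (fun v => N v ω) n (u ++ [i])) =
      cutoff c (fun v => N v ω) n u := by
    filter_upwards [eventually_ge_atTop (u.length + 1)] with n hn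
    exact (cutoff_of_lt c (fun v => N v ω) (n := n) (u := u) (by omega)).symm
  refine Tendsto.congr' hev ?_
  refine (unitInterval.continuous_symm.tendsto _).comp ?_
  by_cases hu : N u ω = ⊤
  · obtain ⟨h1, h2⟩ := h0 hu
    rw [hu, h2]
    refine tendsto_const_nhds.congr' ?_
    filter_upwards [eventually_ge_atTop (u.length + 1)] with n hn
    exact (h1 n (by omega)).symm
  · exact tendsto_liveProd_of_ne_top hu fun i => hω (u ++ [i])

theorem IsFamilySizes.isTreeSolution_cutoffLimit (hN : IsFamilySizes P d N) {ν : Measure I}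
    (hν : IsSolutionLaw d ν) {c : I} (hc : mean ν = c) (hpm : m = 1 - pgf d c)
    (hmp : (c : ℝ) = 1 - pgf d m) (hm : m ≤ 1) (hne : (c : ℝ) ≠ 1 ∧ m ≠ 1 ∨ d {⊤} = 0) :
    IsTreeSolution P N (fun u ω => cutoffLimit c (fun v => N v ω) u.1) := by
  have hsub := hN.indep_of_subtree (measurable_cutoffLimit_subtree N c)
  refine ⟨fun u => measurable_cutoffLimit hN.measurable c _, fun n => ?_, fun n => ?_,
    fun u => ?_, fun u v => map_cutoffLimit_eq hN hN hν hc u v⟩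
  · exact (hsub (2 * n)).1.precomp (g := fun u : {u : EvenNode // u.1.length = 2 * n} =>
        (⟨u.1.1, u.2⟩ : {v : Node // v.length = 2 * n}))
      fun a b hab => Subtype.ext (Subtype.ext (by have h := congrArg Subtype.val hab; exact h))
  · exact (hsub (2 * n)).2.comp
      (φ := fun (x : {v : Node // v.length = 2 * n} → I)
        (u : {u : EvenNode // u.1.length = 2 * n}) => x ⟨u.1.1, u.2⟩)
      (by fun_prop) measurable_id
  · filter_upwards [hN.cutoffLimit_equation hν hc hpm hmp hm hne] with ω hω
    rw [hω u.1, iterStep_eq]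
    congr 1
    funext i
    rw [hω]
    congr 1
    funext j
    simp [EvenNode.grandchild]

theorem isFamilySizes_infinitePi (d : Measure ℕ∞) [IsProbabilityMeasure d] :
    IsFamilySizes (Measure.infinitePi fun _ : Node => d) d (fun v t => t v) :=
  ⟨fun v => measurable_pi_apply v, fun v => Measure.infinitePi_map_eval _ v,
    iIndepFun_infinitePi (X := fun _ x => x) fun _ => measurable_id⟩

/-- The law at a vertex of the limit of the cut-off recursion. -/
noncomputable def endogenousLaw (d : Measure ℕ∞) [IsProbabilityMeasure d] (c : I) : Measure I :=
  (Measure.infinitePi fun _ : Node => d).map fun t => cutoffLimit c t []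

theorem IsFamilySizes.map_cutoffLimit (hN : IsFamilySizes P d N) {ν : Measure I}
    (hν : IsSolutionLaw d ν) {c : I} (hc : mean ν = c) (u : EvenNode) :
    P.map (fun ω => cutoffLimit c (fun v => N v ω) u.1) = endogenousLaw d c :=
  map_cutoffLimit_eq hN (isFamilySizes_infinitePi d) hν hc u ⟨[], by simp⟩

/-- The second moment of the endogenous law is minimal. -/
theorem secondMoment_endogenousLaw_le {ν : Measure I}
    (hν : IsSolutionLaw d ν) {c : I} (hc : mean ν = c) (hpm : m = 1 - pgf d c)
    (hmp : (c : ℝ) = 1 - pgf d m) (hm : m ∈ Set.Icc (0 : ℝ) 1)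
    (hne : (c : ℝ) ≠ 1 ∧ m ≠ 1 ∨ d {⊤} = 0) {x : ℝ} (hcx : (c : ℝ) ^ 2 ≤ x) (hxc : x ≤ c)
    (hx : momentMap d c m x ≤ x) : secondMoment (endogenousLaw d c) ≤ x := by
  have hN := isFamilySizes_infinitePi d
  have hmeas := fun n => measurable_cutoff hN.measurable c n []
  -- The iteration starts from the constant `c`, with second moment `c² ≤ x`; monotonicity and `Φ(x)
  -- ≤ x` keep it below `x`.
  have hiter : ∀ n, secondMoment ((stepLaw d)^[2 * n] (Measure.dirac c)) ≤ x := by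
    intro n
    induction n with
    | zero => simpa [secondMoment] using hcx
    | succ n ih =>
      rw [show 2 * (n + 1) = 2 * n + 1 + 1 by ring, Function.iterate_succ_apply',
        Function.iterate_succ_apply']
      obtain ⟨-, -, h1, h2⟩ := mean_secondMoment_stepLaw_stepLaw hpm hmp hne
        (ν := (stepLaw d)^[2 * n] (Measure.dirac c))
        (by rw [mean_iterate_stepLaw hpm hmp hne (mean_dirac c), if_pos (even_two_mul n)])
      rw [h2]
      exact (momentMap_mono c.2 hm hpm (secondMoment_mem _).1 ih hxc h1).trans hx
  rw [endogenousLaw, secondMoment_map (measurable_cutoffLimit hN.measurable c [])]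
  have hlim := tendsto_integral_unitInterval
    (X := fun n t => cutoff c t n [] * cutoff c t n [])
    (Y := fun t => cutoffLimit c t [] * cutoffLimit c t []) (fun n => (hmeas n).mul (hmeas n))
    ((hN.tendsto_cutoff hν hc).mono fun t ht => (ht []).mul (ht []))
  simp only [← sq, Set.Icc.coe_pow] at hlim
  refine le_of_tendsto hlim (Eventually.of_forall fun n => ?_)
  rw [← secondMoment_map (hmeas n), hN.map_cutoff c (k := 2 * n) (by simp)]
  exact hiter n

end Endogenous

/-! ### The classification of solutions. -/

theorem theorem6p2 (d : Measure ℕ∞) [IsProbabilityMeasure d]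
    (hH0 : pgf d 0 = 0) (hH : StrictConvexOn ℝ (Set.Icc 0 1) (pgf d))
    (μp μm : ℝ) (hμp : μp ∈ Set.Icc (0 : ℝ) 1) (hμm : μm ∈ Set.Icc (0 : ℝ) 1)
    (hpm : μm = 1 - pgf d μp) (hmp : μp = 1 - pgf d μm) :
    -- the discrete solution, as a tree-indexed process, exists on some probability space
    (∃ (Ω : Type) (_ : MeasurableSpace Ω) (P : Measure Ω) (N : Node → Ω → ℕ∞)
        (S : EvenNode → Ω → I),
        IsProbabilityMeasure P ∧ IsFamilySizes P d N ∧ IsDiscreteTreeSolution P N μp S) ∧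
    ∃ ς : Measure I,
      -- the solutions with mean `μp` are the two-point law and the endogenous law `ς`
      {ν : Measure I | IsSolutionLaw d ν ∧ mean ν = μp} = {twoPointLaw μp, ς} ∧
      -- over every realisation of the random tree there is a unique endogenous solution `C`,
      -- its law is `ς`, and it is the conditional probability of every discrete solution
      (∀ (Ω : Type w) [MeasurableSpace Ω] (P : Measure Ω) [IsProbabilityMeasure P]
        (N : Node → Ω → ℕ∞), IsFamilySizes P d N →
        ∃ C : EvenNode → Ω → I,
          IsTreeSolution P N C ∧ IsEndogenous P N C ∧ (∀ u, P.map (C u) = ς) ∧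
          (∀ Z : EvenNode → Ω → I, IsTreeSolution P N Z → IsEndogenous P N Z →
            (∀ u, mean (P.map (Z u)) = μp) → ∀ u, Z u =ᵐ[P] C u) ∧
          ∀ S : EvenNode → Ω → I, IsDiscreteTreeSolution P N μp S →
            (∀ u, (fun ω => (C u ω : ℝ)) =ᵐ[P] treeCondProb P N {ω | S u ω = 1}) ∧
            -- the processes differ exactly when their laws do
            ((∃ u, ¬ S u =ᵐ[P] C u) ↔ twoPointLaw μp ≠ ς)) ∧
      -- the criterion for a non-degenerate two-cycle
      (0 < μp → μp < 1 →
        (twoPointLaw μp ≠ ς ↔ 1 < deriv (pgf d) μm * deriv (pgf d) μp) ∧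
        (twoPointLaw μp ≠ ς ↔ IsUnstableFixedPoint (iterMeanMap d) μp) ∧
        (twoPointLaw μp ≠ ς ↔ IsUnstableFixedPoint (iterMeanMap d) μm)) ∧
      -- the degenerate two-cycles `(0,1)` and `(1,0)`
      (μp = 0 ∨ μp = 1 → twoPointLaw μp = ς) := by
  have hne := twoCycle_ne_one_or hH0 hH hμp hμm hpm hmp
  have htp := isSolutionLaw_twoPointLaw hμp hpm hmp hne
  have htpm := mean_twoPointLaw hμp
  lift μp to I using hμp
  have htree := fun {Ω : Type} [MeasurableSpace Ω] {P : Measure Ω} {N : Node → Ω → ℕ∞}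
    (hN : IsFamilySizes P d N) =>
      hN.isTreeSolution_cutoffLimit htp htpm hpm hmp hμm.2 hne
  have hς : IsSolutionLaw d (endogenousLaw d μp) :=
    (htree (isFamilySizes_infinitePi d)).isSolutionLaw (isFamilySizes_infinitePi d) ⟨[], by simp⟩
  have hςp := hς.1
  obtain ⟨Ω₀, mΩ₀, P₀, N₀, S₀, hP₀, hN₀, hS₀, hS₀law⟩ := htp.exists_isTreeSolution
  have hmean : ∀ {ν : Measure I}, IsSolutionLaw d ν → mean ν = μp →
      0 ≤ 2 * μm - 1 + pgf d (secondMoment ν) ∧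
        momentMap d μp μm (secondMoment ν) = secondMoment ν ∧
        (μp : ℝ) ^ 2 ≤ secondMoment ν ∧ secondMoment ν ≤ μp := by
    intro ν hν hνp
    have := hν.1
    obtain ⟨-, -, h1, h2⟩ := mean_secondMoment_stepLaw_stepLaw hpm hmp hne hνp
    rw [← iterLaw_eq, hν.2] at h2
    exact ⟨h1, h2.symm, hνp ▸ sq_mean_le_secondMoment ν, hνp ▸ secondMoment_le_mean ν⟩
  -- The limit is the conditional expectation of the discrete solution `S₀`, so it inherits the
  -- mean.
  have hςm : mean (endogenousLaw d μp) = μp := by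
    rw [← hN₀.map_cutoffLimit htp htpm ⟨[], by simp⟩,
      mean_map (measurable_cutoffLimit hN₀.measurable _ _),
      ← integral_congr_ae (hS₀.condExp_eq_cutoffLimit hN₀
        (fun u => by rw [hS₀law, htpm]) ⟨[], by simp⟩),
      integral_condExp (iSup_le fun u => (hN₀.measurable u).comap_le),
      ← mean_map (hS₀.measurable _), hS₀law, htpm]
  obtain ⟨hς0, hςfix, hςge, hςle⟩ := hmean hς hςm
  have hmin : ∀ {x : ℝ}, (μp : ℝ) ^ 2 ≤ x → x ≤ μp → momentMap d μp μm x ≤ x →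
      secondMoment (endogenousLaw d μp) ≤ x := fun h1 h2 h3 =>
    secondMoment_endogenousLaw_le htp htpm hpm hmp hμm hne h1 h2 h3
  have hdist : twoPointLaw μp ≠ endogenousLaw d μp ↔
      secondMoment (endogenousLaw d μp) < μp := by
    rw [hςle.lt_iff_ne]
    refine not_congr ⟨fun h => ?_, fun h => (eq_twoPointLaw hςm h).symm⟩
    rw [← h, secondMoment_twoPointLaw μp.2]
  have hcrit : 0 < (μp : ℝ) → (μp : ℝ) < 1 → (twoPointLaw μp ≠ endogenousLaw d μp ↔
      1 < deriv (pgf d) μm * deriv (pgf d) μp) := by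
    intro h0 h1
    rw [hdist]
    refine ⟨fun h => one_lt_of_momentMap_eq hH0 hH μp.2 hμm hpm hmp h0 h1
      (secondMoment_mem _).1 hς0 h hςfix, fun h => ?_⟩
    -- Choosing `x` above `μp²` makes it a valid barrier for the iteration that bounds the second
    -- moment of the endogenous law.
    obtain ⟨x, hx1, hx2, hx3⟩ := exists_momentMap_lt hH0 hH hμm hpm hmp h0 h1 h
      (show (μp : ℝ) ^ 2 < μp by nlinarith)
    exact (hmin hx1.le hx2.le hx3.le).trans_lt hx2
  refine ⟨⟨Ω₀, mΩ₀, P₀, N₀, S₀, hP₀, hN₀, hS₀, fun u => ?_, fun u => by rw [hS₀law, htpm]⟩,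
    endogenousLaw d μp, ?_, ?_, fun h0 h1 => ⟨hcrit h0 h1, ?_, ?_⟩, fun h => ?_⟩
  · have := htp.1
    refine ae_of_ae_map (p := fun x => x = 0 ∨ x = 1) (hS₀.measurable u).aemeasurable ?_
    rw [hS₀law]
    exact ae_eq_zero_or_one ((secondMoment_twoPointLaw μp.2).trans htpm.symm)
  · ext ν
    simp only [Set.mem_ofPred_eq, Set.mem_insert_iff, Set.mem_singleton_iff]
    refine ⟨fun ⟨hν, hνp⟩ => ?_, ?_⟩
    · have := hν.1
      obtain ⟨-, hνfix, hνge, hνle⟩ := hmean hν hνp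
      -- By minimality the second moment of `ν` lies between two known fixed points, that of the
      -- endogenous law and `μp`, so it equals one of them.
      rcases eq_of_momentMap_eq hH0 hH μp.2 hμm hpm hmp (secondMoment_mem _).1 hς0
        (hmin hνge hνle hνfix.le) hνle hςfix hνfix with h | h
      · obtain ⟨Ω, mΩ, P, N, X, hP, hN, hX, hXν⟩ := hν.exists_isTreeSolution
        have hlaw := hN.map_cutoffLimit htp htpm ⟨[], by simp⟩
        have hXC := ae_eq_of_condExp_of_secondMoment_eq
          (iSup_le fun u => (hN.measurable u).comap_le) (hX.measurable ⟨[], by simp⟩)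
          (measurable_cutoffLimit_treeSigma N μp [])
          (hX.condExp_eq_cutoffLimit hN (fun u => by rw [hXν, hνp]) _)
          (by rw [hXν, h, ← hlaw])
        exact Or.inr (by rw [← hXν ⟨[], by simp⟩, ← hlaw, Measure.map_congr hXC])
      · exact Or.inl (eq_twoPointLaw hνp h)
    · rintro (rfl | rfl)
      exacts [⟨htp, htpm⟩, ⟨hς, hςm⟩]
  · intro Ω mΩ P hP N hN
    have hle : treeSigma N ≤ mΩ := iSup_le fun u => (hN.measurable u).comap_le
    have hClaw := hN.map_cutoffLimit htp htpm
    refine ⟨fun u ω => cutoffLimit μp (fun v => N v ω) u.1,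
      hN.isTreeSolution_cutoffLimit htp htpm hpm hmp hμm.2 hne,
      fun u => ⟨_, measurable_cutoffLimit_treeSigma N μp u.1, Filter.EventuallyEq.rfl⟩, hClaw,
      fun Z hZ hZe hZm u => ?_, fun S hS => ⟨fun u => ?_, ?_⟩⟩
    · obtain ⟨Y, hY, hZY⟩ := hZe u
      -- An endogenous variable is its own conditional expectation given the tree, and the latter is
      -- always the cut-off limit.
      have h1 : P[fun ω => (Z u ω : ℝ) | treeSigma N] =ᵐ[P] fun ω => (Y ω : ℝ) := by
        refine (condExp_congr_ae (hZY.fun_comp Subtype.val)).trans ?_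
        rw [condExp_of_stronglyMeasurable hle (measurable_subtype_coe.comp hY).stronglyMeasurable]
        · rfl
        · exact integrable_unitInterval (hY.mono hle le_rfl)
      filter_upwards [hZY, h1, hZ.condExp_eq_cutoffLimit hN hZm u] with ω h2 h3 h4
      exact h2.trans (Subtype.ext (h3.symm.trans h4))
    · refine (hS.solution.condExp_eq_cutoffLimit hN hS.mean_eq u).symm.trans
        (condExp_congr_ae ?_)
      filter_upwards [hS.discrete u] with ω hω
      rcases hω with h | h <;> simp [Set.indicator, h]
    · refine ⟨?_, fun h => ?_⟩
      -- If the laws agree, `S` and its conditional expectation `C` both have second moment `μp`,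
      -- which forces them to coincide.
      · contrapose!
        intro h u
        refine ae_eq_of_condExp_of_secondMoment_eq hle (hS.solution.measurable u)
          (measurable_cutoffLimit_treeSigma N μp u.1)
          (hS.solution.condExp_eq_cutoffLimit hN hS.mean_eq u) ?_
        have hp := Measure.isProbabilityMeasure_map (μ := P) (hS.solution.measurable u).aemeasurable
        rw [hClaw u, ← h, secondMoment_twoPointLaw μp.2, ← hS.mean_eq u,
          mean_map (hS.solution.measurable u), secondMoment_map (hS.solution.measurable u)]
        refine integral_congr_ae ?_
        filter_upwards [hS.discrete u] with ω hω
        rcases hω with h | h <;> simp [h]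
      · contrapose! h
        have hp := Measure.isProbabilityMeasure_map (μ := P)
          (hS.solution.measurable ⟨[], by simp⟩).aemeasurable
        have h2 : secondMoment (P.map (S ⟨[], by simp⟩)) = μp := by
          rw [← hS.mean_eq ⟨[], by simp⟩, mean_map (hS.solution.measurable _),
            secondMoment_map (hS.solution.measurable _)]
          refine integral_congr_ae ?_
          filter_upwards [hS.discrete ⟨[], by simp⟩] with ω hω
          rcases hω with h | h <;> simp [h]
        rw [← eq_twoPointLaw (hS.mean_eq _) h2, ← hClaw ⟨[], by simp⟩]
        exact Measure.map_congr (h _)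
  · rw [isUnstableFixedPoint_iff hH0 hH hμm hpm hmp h0 h1]
    exact hcrit h0 h1
  · obtain ⟨hm0, hm1⟩ := twoCycle_mem_Ioo hH0 hH hμm hpm hmp h0 h1
    rw [isUnstableFixedPoint_iff hH0 hH μp.2 hmp hpm hm0 hm1, mul_comm]
    exact hcrit h0 h1
  · by_contra hd
    have := hdist.1 hd
    -- Here `μp² = μp`, leaving no room for a second moment in `[μp², μp)`.
    rcases h with h | h <;> rw [h] at this hςge <;> linarith
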